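/- Let $M$ be a smooth $7$-manifold and let $\varphi(t)$, $t\in J\subseteq\mathbb R$, be a family of $\mathrm{G}_2$-structures on $M$, that is, of smooth $3$-forms that are positive (at every point $x$, $\varphi(t)_x$ is the model form $e^{123}+e^{145}+e^{167}+e^{246}-e^{257}-e^{347}-e^{356}$ in some basis of $T_x^*M$). Each positive $\varphi$ determines a Riemannian metric $g$ and an orientation with volume form $\mathsf{vol}$ by $$(u\lrcorner\varphi)\wedge(v\lrcorner\varphi)\wedge\varphi=-6\,g(u,v)\,\mathsf{vol},$$ equivalently, in local coordinates, $g_{ij}=6^{-2/9}B_{ij}/\det(B)^{1/9}$ and $\mathsf{vol}=-6^{-7/9}\det(B)^{1/9}\,dx^1\wedge\cdots\wedge dx^7$, where $B_{ij}\,dx^1\wedge\cdots\wedge dx^7=(\partial_i\lrcorner\varphi)\wedge(\partial_j\lrcorner\varphi)\wedge\varphi$. Let $\psi=*\varphi$ be the dual $4$-form, $*$ being the Hodge star of $g$ and $\mathsf{vol}$ (so $\alpha\wedge *\beta=g(\alpha,\beta)\,\mathsf{vol}$). Let $h=h(t)$ be a (possibly time-dependent) symmetric $2$-tensor and $X=X(t)$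 a (possibly time-dependent) vector field on $M$, and suppose that $\varphi(t)$ satisfies the general flow equation for $t\in J$: in all local coordinates $$\frac{\partial}{\partial t}\varphi_{ijk}=h^l_i\varphi_{ljk}+h^l_j\varphi_{ilk}+h^l_k\varphi_{ijl}+X^l\psi_{lijk},$$ where repeated indices are summed from $1$ to $7$, indices are raised and lowered with $g=g(t)$, and $h^l_i=g^{lm}h_{mi}$. Then for all $t\in J$, and in all local coordinates, $\psi_{ijkl}$ is differentiable in $t$ and $$\frac{\partial}{\partial t}\psi_{ijkl}=h^m_i\psi_{mjkl}+h^m_j\psi_{imkl}+h^m_k\psi_{ijml}+h^m_l\psi_{ijkm}-X_i\varphi_{jkl}+X_j\varphi_{ikl}-X_k\varphi_{ijl}+X_l\varphi_{ijk},$$ where $X_k=g_{kl}X^l$. (Time derivatives are taken within $J$.) -/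

import Mathlib

open Set Module
open scoped Manifold ContDiff

noncomputable section

namespace G2Flow

/-! ### Exterior algebra on a seven-dimensional vector space -/

/-- The wedge product of a `k`-form and an `l`-form, as an `n`-form with `n = k + l`:
`(α ∧ β)(v₁, …, vₙ)` is the sum of `sgn σ α(v_σ(1), …, v_σ(k)) β(v_σ(k+1), …, v_σ(n))` over the
`(k, l)`-shuffles `σ`, so that `e¹ ∧ ⋯ ∧ eⁿ` is the determinant. -/
def wedge {V : Type*} [AddCommGroup V] [Module ℝ V] {k l n : ℕ} (h : k + l = n)
    (α : V [⋀^Fin k]→ₗ[ℝ] ℝ) (β : V [⋀^Fin l]→ₗ[ℝ] ℝ) : V [⋀^Fin n]→ₗ[ℝ] ℝ :=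
  ((LinearMap.mul' ℝ ℝ).compAlternatingMap (α.domCoprod β)).domDomCongr
    (finSumFinEquiv.trans (finCongr h))

/-- The decomposable three-form `eⁱ ∧ eʲ ∧ eᵏ` built from the basis dual to `b`. -/
def dualTriple {V : Type*} [AddCommGroup V] [Module ℝ V] (b : Basis (Fin 7) ℝ V)
    (i j k : Fin 7) : V [⋀^Fin 3]→ₗ[ℝ] ℝ :=
  (Matrix.detRowAlternating (R := ℝ) (n := Fin 3)).compLinearMap
    (LinearMap.pi ![b.coord i, b.coord j, b.coord k])

/-- The model `G₂` three-form
`e¹²³ + e¹⁴⁵ + e¹⁶⁷ + e²⁴⁶ - e²⁵⁷ - e³⁴⁷ - e³⁵⁶` in the basis `b` (indices here start at `0`). -/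
def modelForm {V : Type*} [AddCommGroup V] [Module ℝ V] (b : Basis (Fin 7) ℝ V) :
    V [⋀^Fin 3]→ₗ[ℝ] ℝ :=
  dualTriple b 0 1 2 + dualTriple b 0 3 4 + dualTriple b 0 5 6 + dualTriple b 1 3 5
    - dualTriple b 1 4 6 - dualTriple b 2 3 6 - dualTriple b 2 4 5

/-- A three-form is positive if it is the model form in some basis, that is, if it lies in the
`GL(7, ℝ)`-orbit of the model form. -/
def IsPositive {V : Type*} [AddCommGroup V] [Module ℝ V] (φ : V [⋀^Fin 3]→ₗ[ℝ] ℝ) : Prop :=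
  ∃ b : Basis (Fin 7) ℝ V, φ = modelForm b

/-- The top form `(u ⌟ φ) ∧ (v ⌟ φ) ∧ φ`. -/
def topForm {V : Type*} [AddCommGroup V] [Module ℝ V] (φ : V [⋀^Fin 3]→ₗ[ℝ] ℝ) (u v : V) :
    V [⋀^Fin 7]→ₗ[ℝ] ℝ :=
  wedge (show 4 + 3 = 7 from rfl)
    (wedge (show 2 + 2 = 4 from rfl) (φ.curryLeft u) (φ.curryLeft v)) φ

/-- The matrix `B_ij`, with
`B_ij dx¹ ∧ ⋯ ∧ dx⁷ = (∂_i ⌟ φ) ∧ (∂_j ⌟ φ) ∧ φ`, in the basis `b`. -/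
def matrixB {V : Type*} [AddCommGroup V] [Module ℝ V] (b : Basis (Fin 7) ℝ V)
    (φ : V [⋀^Fin 3]→ₗ[ℝ] ℝ) : Matrix (Fin 7) (Fin 7) ℝ :=
  fun i j => topForm φ (b i) (b j) b

/-- The real ninth root, an odd function. -/
def ninthRoot (x : ℝ) : ℝ := Real.sign x * |x| ^ (1 / 9 : ℝ)

/-- The metric of a positive three-form:
`g(u, v) = 6^(-2/9) * B(u, v) / det(B)^(1/9)`, where
`B(u, v)` is the value of `(u ⌟ φ) ∧ (v ⌟ φ) ∧ φ` on the basis `b`.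
It does not depend on `b`, see `metric_eq`. -/
def metric {V : Type*} [AddCommGroup V] [Module ℝ V] (b : Basis (Fin 7) ℝ V)
    (φ : V [⋀^Fin 3]→ₗ[ℝ] ℝ) (u v : V) : ℝ :=
  (6 : ℝ) ^ (-(2 / 9) : ℝ) * (topForm φ u v b / ninthRoot (matrixB b φ).det)

/-- The volume form of a positive three-form, for the orientation with
`(u ⌟ φ) ∧ (v ⌟ φ) ∧ φ = -6 g(u, v) vol`; its value on the basis `b` is
`-6^(-7/9) det(B)^(1/9)`, which is `√det(g)` if `b` is oriented and `-√det(g)` if not.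
It does not depend on `b`, see `volumeForm_eq`. -/
def volumeForm {V : Type*} [AddCommGroup V] [Module ℝ V] (b : Basis (Fin 7) ℝ V)
    (φ : V [⋀^Fin 3]→ₗ[ℝ] ℝ) : V [⋀^Fin 7]→ₗ[ℝ] ℝ :=
  (-((6 : ℝ) ^ (-(7 / 9) : ℝ) * ninthRoot (matrixB b φ).det)) • b.det

/-- The matrix `g_ij` of `g` in a frame. -/
def gram {V : Type*} (g : V → V → ℝ) (b : Fin 7 → V) : Matrix (Fin 7) (Fin 7) ℝ :=
  fun i j => g (b i) (b j)

/-- The vector `g^{ai} b_i`, metric dual to the `a`-th element of the dual basis. -/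
def raised {V : Type*} [AddCommGroup V] [Module ℝ V] (g : V → V → ℝ) (b : Fin 7 → V)
    (a : Fin 7) : V :=
  ∑ i, (gram g b)⁻¹ a i • b i

/-- The inner product of three-forms induced by `g`,
`g(α, β) = (1/3!) α_{abc} β_{ijk} g^{ai} g^{bj} g^{ck}`. -/
def innerThree {V : Type*} [AddCommGroup V] [Module ℝ V] (g : V → V → ℝ) (b : Fin 7 → V)
    (α β : V [⋀^Fin 3]→ₗ[ℝ] ℝ) : ℝ :=
  (1 / 6 : ℝ) * ∑ i, ∑ j, ∑ k,
    α ![raised g b i, raised g b j, raised g b k] * β ![b i, b j, b k]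

/-- The Hodge star on three-forms,
`(* β)_{jklm} = (1/3!) β_{abc} g^{ad} g^{be} g^{cf} vol_{defjklm}`.
It satisfies `α ∧ * β = g(α, β) vol` for all three-forms `α`, see `wedge_hodgeStar`. -/
def hodgeStar {V : Type*} [AddCommGroup V] [Module ℝ V] (g : V → V → ℝ)
    (vol : V [⋀^Fin 7]→ₗ[ℝ] ℝ) (b : Fin 7 → V) (β : V [⋀^Fin 3]→ₗ[ℝ] ℝ) :
    V [⋀^Fin 4]→ₗ[ℝ] ℝ :=
  (1 / 6 : ℝ) • ∑ i, ∑ j, ∑ k, β ![b i, b j, b k] •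
    ((vol.curryLeft (raised g b i)).curryLeft (raised g b j)).curryLeft (raised g b k)

/-- The dual four-form `ψ = * φ` of a positive three-form.
It does not depend on `b`, see `dualForm_eq`. -/
def dualForm {V : Type*} [AddCommGroup V] [Module ℝ V] (b : Basis (Fin 7) ℝ V)
    (φ : V [⋀^Fin 3]→ₗ[ℝ] ℝ) : V [⋀^Fin 4]→ₗ[ℝ] ℝ :=
  hodgeStar (metric b φ) (volumeForm b φ) b φ

theorem ninthRoot_pow_mul (x y : ℝ) : ninthRoot (x ^ 9 * y) = x * ninthRoot y := by
  have h : |x ^ 9| ^ (1 / 9 : ℝ) = |x| := by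
    rw [abs_pow, ← Real.rpow_natCast, ← Real.rpow_mul (abs_nonneg x)]
    norm_num
  unfold ninthRoot
  rw [abs_mul, Real.mul_rpow (abs_nonneg _) (abs_nonneg y), h]
  rcases lt_trichotomy x 0 with hx | hx | hx
  · have hp : x ^ 9 < 0 := Odd.pow_neg (by decide) hx
    rw [abs_of_neg hx]
    rcases lt_trichotomy y 0 with hy | hy | hy
    · rw [Real.sign_of_neg hy, Real.sign_of_pos (mul_pos_of_neg_of_neg hp hy)]; ring
    · simp [hy]
    · rw [Real.sign_of_pos hy, Real.sign_of_neg (mul_neg_of_neg_of_pos hp hy)]; ring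
  · simp [hx]
  · have hp : 0 < x ^ 9 := by positivity
    rw [abs_of_pos hx]
    rcases lt_trichotomy y 0 with hy | hy | hy
    · rw [Real.sign_of_neg hy, Real.sign_of_neg (mul_neg_of_pos_of_neg hp hy)]; ring
    · simp [hy]
    · rw [Real.sign_of_pos hy, Real.sign_of_pos (mul_pos hp hy)]; ring

/-- The wedge product as a bilinear map. -/
def wedgeHom (V : Type*) [AddCommGroup V] [Module ℝ V] {k l n : ℕ} (h : k + l = n) :
    (V [⋀^Fin k]→ₗ[ℝ] ℝ) →ₗ[ℝ] (V [⋀^Fin l]→ₗ[ℝ] ℝ) →ₗ[ℝ] (V [⋀^Fin n]→ₗ[ℝ] ℝ) :=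
  LinearMap.mk₂ ℝ (wedge h)
    (fun α α' β => by
      ext v
      simp [wedge, ← AlternatingMap.domCoprod'_apply, TensorProduct.add_tmul])
    (fun c α β => by
      ext v
      simp [wedge, ← AlternatingMap.domCoprod'_apply, ← TensorProduct.smul_tmul'])
    (fun α β β' => by
      ext v
      simp [wedge, ← AlternatingMap.domCoprod'_apply, TensorProduct.tmul_add])
    (fun c α β => by
      ext v
      simp [wedge, ← AlternatingMap.domCoprod'_apply])

theorem wedgeHom_apply {V : Type*} [AddCommGroup V] [Module ℝ V] {k l n : ℕ} (h : k + l = n)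
    (α : V [⋀^Fin k]→ₗ[ℝ] ℝ) (β : V [⋀^Fin l]→ₗ[ℝ] ℝ) :
    wedgeHom V h α β = wedge h α β := rfl

/-- Evaluation of alternating forms at a tuple, as a linear map. -/
def evalAt {V : Type*} [AddCommGroup V] [Module ℝ V] {n : ℕ} (v : Fin n → V) :
    (V [⋀^Fin n]→ₗ[ℝ] ℝ) →ₗ[ℝ] ℝ where
  toFun f := f v
  map_add' _ _ := rfl
  map_smul' _ _ := rfl

theorem evalAt_apply {V : Type*} [AddCommGroup V] [Module ℝ V] {n : ℕ} (v : Fin n → V)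
    (f : V [⋀^Fin n]→ₗ[ℝ] ℝ) : evalAt v f = f v := rfl

theorem topForm_apply_basis {V : Type*} [AddCommGroup V] [Module ℝ V]
    (b b' : Basis (Fin 7) ℝ V) (φ : V [⋀^Fin 3]→ₗ[ℝ] ℝ) (u v : V) :
    topForm φ u v b' = b.det b' * topForm φ u v b := by
  conv_lhs => rw [AlternatingMap.eq_smul_basis_det b (topForm φ u v)]
  simp [mul_comm]

theorem topForm_sum {V : Type*} [AddCommGroup V] [Module ℝ V]
    (b : Fin 7 → V) (φ : V [⋀^Fin 3]→ₗ[ℝ] ℝ) (x y : Fin 7 → ℝ) :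
    topForm φ (∑ i, x i • b i) (∑ j, y j • b j) =
      ∑ i, ∑ j, (x i * y j) • topForm φ (b i) (b j) := by
  simp only [topForm, ← wedgeHom_apply, map_sum, map_smul, LinearMap.sum_apply,
    LinearMap.smul_apply, Finset.smul_sum, smul_smul]
  rw [Finset.sum_comm]
  simp only [mul_comm]

theorem topForm_sum_apply {V : Type*} [AddCommGroup V] [Module ℝ V]
    (b w : Fin 7 → V) (φ : V [⋀^Fin 3]→ₗ[ℝ] ℝ) (x y : Fin 7 → ℝ) :
    topForm φ (∑ i, x i • b i) (∑ j, y j • b j) w =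
      ∑ i, ∑ j, x i * y j * topForm φ (b i) (b j) w := by
  rw [topForm_sum, ← evalAt_apply]
  simp only [map_sum, map_smul, evalAt_apply, smul_eq_mul]

theorem congruence_apply (F P : Matrix (Fin 7) (Fin 7) ℝ) (i j : Fin 7) :
    (P.transpose * F * P) i j = ∑ k, ∑ l, P k i * P l j * F k l := by
  rw [Finset.sum_comm]
  simp only [Matrix.mul_apply, Matrix.transpose_apply, Finset.sum_mul]
  refine Finset.sum_congr rfl fun _ _ => Finset.sum_congr rfl fun _ _ => by ring

theorem matrixB_apply {V : Type*} [AddCommGroup V] [Module ℝ V]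
    (b : Basis (Fin 7) ℝ V) (φ : V [⋀^Fin 3]→ₗ[ℝ] ℝ) (i j : Fin 7) :
    matrixB b φ i j = topForm φ (b i) (b j) b := rfl

theorem matrixB_eq_aux {V : Type*} [AddCommGroup V] [Module ℝ V]
    (b b' : Basis (Fin 7) ℝ V) (φ : V [⋀^Fin 3]→ₗ[ℝ] ℝ) (d : ℝ) (P : Matrix (Fin 7) (Fin 7) ℝ)
    (hd : ∀ u v, topForm φ u v b' = d * topForm φ u v b)
    (hP : ∀ i, b' i = ∑ k, P k i • b k) :
    matrixB b' φ = d • (P.transpose * matrixB b φ * P) := by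
  ext i j
  rw [matrixB_apply, Matrix.smul_apply, smul_eq_mul, hd, congruence_apply, hP i, hP j,
    topForm_sum_apply]
  simp only [matrixB_apply]

theorem matrixB_eq {V : Type*} [AddCommGroup V] [Module ℝ V]
    (b b' : Basis (Fin 7) ℝ V) (φ : V [⋀^Fin 3]→ₗ[ℝ] ℝ) :
    matrixB b' φ =
      b.det b' • ((b.toMatrix b').transpose * matrixB b φ * b.toMatrix b') :=
  matrixB_eq_aux b b' φ _ _ (topForm_apply_basis b b' φ)
    fun i => by simp [Basis.toMatrix_apply, b.sum_repr]

theorem ninthRoot_matrixB {V : Type*} [AddCommGroup V] [Module ℝ V]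
    (b b' : Basis (Fin 7) ℝ V) (φ : V [⋀^Fin 3]→ₗ[ℝ] ℝ) :
    ninthRoot (matrixB b' φ).det = b.det b' * ninthRoot (matrixB b φ).det := by
  rw [← ninthRoot_pow_mul, matrixB_eq b b', Matrix.det_smul, Matrix.det_mul, Matrix.det_mul,
    Matrix.det_transpose, Basis.det_apply, Fintype.card_fin]
  congr 1
  ring

/-- The metric does not depend on the basis used to write it down. -/
theorem metric_eq {V : Type*} [AddCommGroup V] [Module ℝ V]
    (b b' : Basis (Fin 7) ℝ V) (φ : V [⋀^Fin 3]→ₗ[ℝ] ℝ) : metric b' φ = metric b φ := by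
  funext u v
  have h : b.det b' ≠ 0 := (b.isUnit_det b').ne_zero
  rw [metric, metric, ninthRoot_matrixB b b', topForm_apply_basis b b',
    mul_div_mul_left _ _ h]

/-- The volume form does not depend on the basis used to write it down. -/
theorem volumeForm_eq {V : Type*} [AddCommGroup V] [Module ℝ V]
    (b b' : Basis (Fin 7) ℝ V) (φ : V [⋀^Fin 3]→ₗ[ℝ] ℝ) :
    volumeForm b' φ = volumeForm b φ := by
  have h : b.det = b.det b' • b'.det := AlternatingMap.eq_smul_basis_det b' b.det
  rw [volumeForm, volumeForm, ninthRoot_matrixB b b']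
  conv_rhs => rw [h]
  rw [smul_smul]
  congr 1
  ring

theorem wedge_eq_single {V : Type*} [AddCommGroup V] [Module ℝ V] {k l n : ℕ} (h : k + l = n)
    (α : V [⋀^Fin k]→ₗ[ℝ] ℝ) (β : V [⋀^Fin l]→ₗ[ℝ] ℝ) (v : Fin n → V)
    (hβ : ∀ σ : Equiv.Perm (Fin k ⊕ Fin l), ∀ x y, σ (Sum.inr x) = Sum.inl y →
      β (fun i => v (finCongr h (finSumFinEquiv (σ (Sum.inr i))))) = 0) :
    wedge h α β v = α (fun i => v (finCongr h (finSumFinEquiv (Sum.inl i)))) *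
      β (fun i => v (finCongr h (finSumFinEquiv (Sum.inr i)))) := by
  simp only [wedge, AlternatingMap.domDomCongr_apply, LinearMap.compAlternatingMap_apply,
    AlternatingMap.domCoprod_apply]
  rw [_root_.sum_apply, map_sum]
  refine (Finset.sum_eq_single
    (Quotient.mk'' 1 : Equiv.Perm.ModSumCongr (Fin k) (Fin l)) ?_ ?_).trans ?_
  rotate_left 2
  · rw [AlternatingMap.domCoprod.summand_mk'']
    simp
  · intro σ _ hσ
    induction σ using Quotient.inductionOn' with
    | h σ =>
    rw [AlternatingMap.domCoprod.summand_mk'']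
    have hr : ¬ ∀ x : Fin l, ∃ y : Fin l, σ (Sum.inr x) = Sum.inr y := by
      intro hx
      apply hσ
      rw [eq_comm]
      apply Quotient.sound'
      rw [QuotientGroup.leftRel_apply]
      simp only [inv_one, one_mul]
      apply Equiv.Perm.mem_sumCongrHom_range_of_perm_mapsTo_inl
      rw [Equiv.Perm.perm_mapsTo_inl_iff_mapsTo_inr]
      rintro _ ⟨x, rfl⟩
      obtain ⟨y, hy⟩ := hx x
      exact ⟨y, hy.symm⟩
    push Not at hr
    obtain ⟨x, hx⟩ := hr
    obtain ⟨y, hy⟩ : ∃ y : Fin k, σ (Sum.inr x) = Sum.inl y := by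
      cases h : σ (Sum.inr x) with
      | inl y => exact ⟨y, rfl⟩
      | inr y => exact absurd h (hx y)
    rw [_root_.smul_apply, LinearMap.map_smul_of_tower]
    simp only [MultilinearMap.domDomCongr_apply, MultilinearMap.domCoprod_apply,
      LinearMap.mul'_apply, Function.comp_apply, Equiv.trans_apply,
      AlternatingMap.coe_multilinearMap]
    rw [hβ σ x y hy, mul_zero, smul_zero]
  · simp

theorem wedge_contract_basis_aux {V : Type*} [AddCommGroup V] [Module ℝ V]
    (b : Fin 7 → V) (vol : V [⋀^Fin 7]→ₗ[ℝ] ℝ) (α : V [⋀^Fin 3]→ₗ[ℝ] ℝ) :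
    wedge (show 3 + 4 = 7 from rfl) α
      (((vol.curryLeft (b 0)).curryLeft (b 1)).curryLeft (b 2)) b =
        α ![b 0, b 1, b 2] * vol b := by
  have h1 : (fun i : Fin 3 => b (finCongr (show 3 + 4 = 7 from rfl)
      (finSumFinEquiv (Sum.inl i)))) = ![b 0, b 1, b 2] := by
    funext i; fin_cases i <;> rfl
  have h2 : Matrix.vecCons (b 0) (Matrix.vecCons (b 1) (Matrix.vecCons (b 2)
      (fun i : Fin 4 => b (finCongr (show 3 + 4 = 7 from rfl)
        (finSumFinEquiv (Sum.inr i)))))) = b := by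
    funext i; fin_cases i <;> rfl
  rw [wedge_eq_single, h1, AlternatingMap.curryLeft_apply_apply,
    AlternatingMap.curryLeft_apply_apply, AlternatingMap.curryLeft_apply_apply, h2]
  intro σ x y hy
  simp only [AlternatingMap.curryLeft_apply_apply]
  refine vol.map_eq_zero_of_eq _ (i := Fin.castAdd 4 y) (j := Fin.natAdd 3 x) ?_ ?_
  · have h3 : b (finCongr (show 3 + 4 = 7 from rfl) (finSumFinEquiv (σ (Sum.inr x)))) =
        b (Fin.castAdd 4 y) := by
      rw [hy]; rfl
    have h4 : Matrix.vecCons (b 0) (Matrix.vecCons (b 1) (Matrix.vecCons (b 2)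
      (fun i : Fin 4 => b (finCongr (show 3 + 4 = 7 from rfl)
        (finSumFinEquiv (σ (Sum.inr i))))))) (Fin.natAdd 3 x) =
        b (finCongr (show 3 + 4 = 7 from rfl) (finSumFinEquiv (σ (Sum.inr x)))) := by
      fin_cases x <;> rfl
    refine Eq.trans ?_ (h4.trans h3).symm
    fin_cases y <;> rfl
  · intro h
    have := congrArg Fin.val h
    simp at this
    omega

theorem eq_smul_of_basis {V : Type*} [AddCommGroup V] [Module ℝ V]
    (b : Basis (Fin 7) ℝ V) (f f' : V [⋀^Fin 7]→ₗ[ℝ] ℝ) (c : ℝ) (h : f b = c * f' b) :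
    f = c • f' := by
  have h1 := AlternatingMap.eq_smul_basis_det b f
  have h2 := AlternatingMap.eq_smul_basis_det b f'
  generalize b.det = D at *
  rw [h1, h, mul_smul, ← h2]

theorem wedge_contract_basis {V : Type*} [AddCommGroup V] [Module ℝ V]
    (b : Basis (Fin 7) ℝ V) (vol : V [⋀^Fin 7]→ₗ[ℝ] ℝ) (α : V [⋀^Fin 3]→ₗ[ℝ] ℝ) :
    wedge (show 3 + 4 = 7 from rfl) α
      (((vol.curryLeft (b 0)).curryLeft (b 1)).curryLeft (b 2)) =
      α ![b 0, b 1, b 2] • vol :=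
  eq_smul_of_basis b _ _ _ (wedge_contract_basis_aux b vol α)

theorem wedge_contract {V : Type*} [AddCommGroup V] [Module ℝ V]
    (b : Basis (Fin 7) ℝ V) (vol : V [⋀^Fin 7]→ₗ[ℝ] ℝ) (α : V [⋀^Fin 3]→ₗ[ℝ] ℝ) (u v w : V) :
    wedge (show 3 + 4 = 7 from rfl) α (((vol.curryLeft u).curryLeft v).curryLeft w) = α ![u, v, w] • vol := by
  have hα : ∀ u v w, α ![u, v, w] =
    evalAt ![] (((α.curryLeft u).curryLeft v).curryLeft w) := fun _ _ _ => rfl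
  have hz : ∀ i j k : Fin 7,
      wedge (show 3 + 4 = 7 from rfl) α (((vol.curryLeft (b i)).curryLeft (b j)).curryLeft (b k)) =
        α ![b i, b j, b k] • vol := by
    intro i j k
    by_cases hinj : Function.Injective ![i, j, k]
    · obtain ⟨τ, hτ⟩ : ∃ τ : Equiv.Perm (Fin 7), ∀ a : Fin 3,
          τ (Fin.castAdd 4 a) = ![i, j, k] a :=
        Equiv.Perm.exists_extending_pair _ _ (Fin.castAdd_injective 3 4) hinj
      have := wedge_contract_basis (b.reindex τ.symm) vol α
      have h0 := hτ 0
      have h1 := hτ 1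
      have h2 := hτ 2
      simp at h0 h1 h2
      simpa [h0, h1, h2] using this
    · have h3 : ∀ n (f : V [⋀^Fin (n + 3)]→ₗ[ℝ] ℝ),
          (((f.curryLeft (b i)).curryLeft (b j)).curryLeft (b k)) = 0 := by
        intro n f
        have : i = j ∨ i = k ∨ j = k := by
          by_contra! h
          apply hinj
          intro x y
          fin_cases x <;> fin_cases y <;> simp [h.1, h.2.1, h.2.2, h.1.symm, h.2.1.symm, h.2.2.symm]
        ext x
        simp only [AlternatingMap.curryLeft_apply_apply, AlternatingMap.zero_apply]
        rcases this with h | h | h <;> replace h := congrArg b h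
        · exact f.map_eq_zero_of_eq _ (i := ⟨0, by omega⟩) (j := ⟨1, by omega⟩) (by exact h) (by simp)
        · exact f.map_eq_zero_of_eq _ (i := ⟨0, by omega⟩) (j := ⟨2, by omega⟩) (by exact h) (by simp)
        · exact f.map_eq_zero_of_eq _ (i := ⟨1, by omega⟩) (j := ⟨2, by omega⟩) (by exact h) (by simp)
      rw [hα, h3 4, h3 0, ← wedgeHom_apply]
      simp
  rw [hα, ← b.sum_repr u, ← b.sum_repr v, ← b.sum_repr w]
  simp only [hα] at hz
  simp only [← wedgeHom_apply, ← AlternatingMap.curryLeftLinearMap_apply] at hz ⊢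
  simp only [map_sum, map_smul, LinearMap.sum_apply, LinearMap.smul_apply, hz,
    Finset.sum_smul, smul_assoc]

/-- The defining property of the Hodge star. -/
theorem wedge_hodgeStar {V : Type*} [AddCommGroup V] [Module ℝ V]
    (b : Basis (Fin 7) ℝ V) (g : V → V → ℝ) (vol : V [⋀^Fin 7]→ₗ[ℝ] ℝ)
    (α β : V [⋀^Fin 3]→ₗ[ℝ] ℝ) :
    wedge (show 3 + 4 = 7 from rfl) α (hodgeStar g vol b β) = innerThree g b α β • vol := by
  simp only [hodgeStar, ← wedgeHom_apply, map_sum, map_smul]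
  simp only [wedgeHom_apply, wedge_contract b, innerThree, smul_smul, ← Finset.sum_smul]
  simp only [mul_comm]

theorem metric_gram_eq {V : Type*} [AddCommGroup V] [Module ℝ V]
    (b b' : Basis (Fin 7) ℝ V) (φ : V [⋀^Fin 3]→ₗ[ℝ] ℝ) (P : Matrix (Fin 7) (Fin 7) ℝ)
    (hP : ∀ i, b' i = ∑ k, P k i • b k) :
    gram (metric b φ) b' = P.transpose * gram (metric b φ) b * P := by
  ext i j
  rw [congruence_apply, gram, hP i, hP j]
  simp only [metric, topForm_sum_apply, gram, Finset.sum_div, Finset.mul_sum]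
  refine Finset.sum_congr rfl fun _ _ => Finset.sum_congr rfl fun _ _ => by ring

theorem contract_eq {V N : Type*} [AddCommGroup V] [Module ℝ V] [AddCommGroup N] [Module ℝ N]
    (g : V → V → ℝ) (b b' : Fin 7 → V) (P Q : Matrix (Fin 7) (Fin 7) ℝ) (hPQ : P * Q = 1)
    (hP : ∀ i, b' i = ∑ k, P k i • b k)
    (hg : gram g b' = P.transpose * gram g b * P) (F : V →ₗ[ℝ] V →ₗ[ℝ] N) :
    ∑ a, F (b' a) (raised g b' a) = ∑ a, F (b a) (raised g b a) := by
  have hQ : P⁻¹ = Q := Matrix.inv_eq_right_inv hPQ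
  have hr : ∀ a, raised g b' a = ∑ c, Q a c • raised g b c := by
    intro a
    have h1 : (gram g b')⁻¹ * P.transpose = Q * (gram g b)⁻¹ := by
      rw [hg, Matrix.mul_inv_rev, Matrix.mul_inv_rev, hQ, Matrix.mul_assoc, Matrix.mul_assoc,
        ← Matrix.transpose_nonsing_inv, hQ, ← Matrix.transpose_mul, hPQ, Matrix.transpose_one,
        Matrix.mul_one]
    have h2 : ∀ k, ∑ i, (gram g b')⁻¹ a i * P k i = ∑ c, Q a c * (gram g b)⁻¹ c k := fun k => by
      have := congrFun (congrFun h1 a) k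
      simpa only [Matrix.mul_apply, Matrix.transpose_apply] using this
    simp only [raised, hP, Finset.smul_sum, smul_smul]
    rw [Finset.sum_comm]
    conv_rhs => rw [Finset.sum_comm]
    simp only [← Finset.sum_smul, h2]
  simp only [hr, hP, map_sum, map_smul, LinearMap.sum_apply, LinearMap.smul_apply,
    Finset.smul_sum, smul_smul]
  rw [Finset.sum_comm]
  have h3 : ∀ c k, ∑ a, Q a c * P k a = (1 : Matrix (Fin 7) (Fin 7) ℝ) k c := fun c k => by
    rw [← hPQ, Matrix.mul_apply]
    exact Finset.sum_congr rfl fun _ _ => mul_comm _ _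
  refine Finset.sum_congr rfl fun c _ => ?_
  rw [Finset.sum_comm]
  simp only [← Finset.sum_smul, h3, Matrix.one_apply, ite_smul, one_smul, zero_smul,
    Finset.sum_ite_eq', Finset.mem_univ, if_true]

/-- The dual four-form does not depend on the basis used to write it down. -/
theorem dualForm_eq {V : Type*} [AddCommGroup V] [Module ℝ V]
    (b b' : Basis (Fin 7) ℝ V) (φ : V [⋀^Fin 3]→ₗ[ℝ] ℝ) : dualForm b' φ = dualForm b φ := by
  have hP : ∀ i, b' i = ∑ k, b.toMatrix b' k i • b k := fun i => by
    simp [Basis.toMatrix_apply, b.sum_repr]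
  have hc : ∀ F : V → V → (V [⋀^Fin 4]→ₗ[ℝ] ℝ),
      (∀ x y z, F (x + y) z = F x z + F y z) → (∀ (c : ℝ) x z, F (c • x) z = c • F x z) →
      (∀ x y z, F x (y + z) = F x y + F x z) → (∀ (c : ℝ) x z, F x (c • z) = c • F x z) →
      ∑ a, F (b' a) (raised (metric b φ) b' a) = ∑ a, F (b a) (raised (metric b φ) b a) :=
    fun F h1 h2 h3 h4 =>
      contract_eq (metric b φ) b b' (b.toMatrix b') (b'.toMatrix b)
        (b.toMatrix_mul_toMatrix_flip b') hP (metric_gram_eq b b' φ _ hP)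
        (LinearMap.mk₂ ℝ F h1 h2 h3 h4)
  rw [dualForm, dualForm, metric_eq b b', volumeForm_eq b b']
  generalize metric b φ = g at *
  generalize volumeForm b φ = vol at *
  have hφ : ∀ u v w, φ ![u, v, w] =
    evalAt ![] (((φ.curryLeft u).curryLeft v).curryLeft w) := fun _ _ _ => rfl
  simp only [hodgeStar, hφ, ← AlternatingMap.curryLeftLinearMap_apply]
  congr 1
  have s1 := hc (fun u u' => ∑ j, ∑ k,
    evalAt ![] (AlternatingMap.curryLeftLinearMap (AlternatingMap.curryLeftLinearMap
      (AlternatingMap.curryLeftLinearMap φ u) (b j)) (b k)) •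
    AlternatingMap.curryLeftLinearMap (AlternatingMap.curryLeftLinearMap
      (AlternatingMap.curryLeftLinearMap vol u') (raised g b j)) (raised g b k))
    (by simp [add_smul, Finset.sum_add_distrib])
    (by simp [mul_smul, Finset.smul_sum])
    (by simp [Finset.sum_add_distrib])
    (by simp [Finset.smul_sum, smul_smul, mul_comm])
  rw [← s1]
  refine Finset.sum_congr rfl fun i _ => ?_
  have s2 := hc (fun v v' => ∑ k,
    evalAt ![] (AlternatingMap.curryLeftLinearMap (AlternatingMap.curryLeftLinearMap
      (AlternatingMap.curryLeftLinearMap φ (b' i)) v) (b k)) •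
    AlternatingMap.curryLeftLinearMap (AlternatingMap.curryLeftLinearMap
      (AlternatingMap.curryLeftLinearMap vol (raised g b' i)) v') (raised g b k))
    (by simp [add_smul, Finset.sum_add_distrib])
    (by simp [mul_smul, Finset.smul_sum])
    (by simp [Finset.sum_add_distrib])
    (by simp [Finset.smul_sum, smul_smul, mul_comm])
  rw [← s2]
  refine Finset.sum_congr rfl fun j _ => ?_
  exact hc (fun w w' =>
    evalAt ![] (AlternatingMap.curryLeftLinearMap (AlternatingMap.curryLeftLinearMap
      (AlternatingMap.curryLeftLinearMap φ (b' i)) (b' j)) w) •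
    AlternatingMap.curryLeftLinearMap (AlternatingMap.curryLeftLinearMap
      (AlternatingMap.curryLeftLinearMap vol (raised g b' i)) (raised g b' j)) w')
    (by simp [add_smul])
    (by simp [mul_smul])
    (by simp)
    (by simp [smul_smul, mul_comm])

/-! ### `G₂`-structures on a seven-manifold and their flows -/

/-- The coordinate basis of `T_x M` for the preferred chart at `x`. -/
def tangentBasis {M : Type*} [TopologicalSpace M] [ChartedSpace (EuclideanSpace ℝ (Fin 7)) M]
    (x : M) : Basis (Fin 7) ℝ (TangentSpace (𝓡 7) x) :=
  (EuclideanSpace.basisFun (Fin 7) ℝ).toBasis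

/-- The coordinate vector field `∂/∂xⁱ` of the chart `e`, at the point with coordinates `y`. -/
def coordFrame {M : Type*} [TopologicalSpace M] [ChartedSpace (EuclideanSpace ℝ (Fin 7)) M]
    (e : OpenPartialHomeomorph M (EuclideanSpace ℝ (Fin 7))) (y : EuclideanSpace ℝ (Fin 7))
    (i : Fin 7) : TangentSpace (𝓡 7) (e.symm y) :=
  mfderiv (𝓡 7) (𝓡 7) e.symm y (EuclideanSpace.single i (1 : ℝ) : EuclideanSpace ℝ (Fin 7))

/-- The coordinate `v^l = dx^l(v)` of a tangent vector in the chart `e`, at the point with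
coordinates `y`. -/
def coordComponent {M : Type*} [TopologicalSpace M]
    [ChartedSpace (EuclideanSpace ℝ (Fin 7)) M]
    (e : OpenPartialHomeomorph M (EuclideanSpace ℝ (Fin 7))) (y : EuclideanSpace ℝ (Fin 7))
    (v : TangentSpace (𝓡 7) (e.symm y)) (l : Fin 7) : ℝ :=
  (show EuclideanSpace ℝ (Fin 7) from mfderiv (𝓡 7) (𝓡 7) e (e.symm y) v) l

/-- A `G₂`-structure on a seven-manifold: a smooth positive three-form. -/
structure G2Structure (M : Type*) [TopologicalSpace M]
    [ChartedSpace (EuclideanSpace ℝ (Fin 7)) M] where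
  /-- The three-form. -/
  form : ∀ x : M, TangentSpace (𝓡 7) x [⋀^Fin 3]→ₗ[ℝ] ℝ
  /-- The components of the form in every chart of the smooth structure are smooth. -/
  smooth : ∀ e ∈ IsManifold.maximalAtlas (𝓡 7) ∞ M, ∀ i j k : Fin 7,
    ContDiffOn ℝ ∞ (fun y => form (e.symm y)
      ![coordFrame e y i, coordFrame e y j, coordFrame e y k]) e.target
  /-- The form is positive at every point. -/
  positive : ∀ x, IsPositive (form x)

/-- The Riemannian metric of a `G₂`-structure. -/
def G2Structure.metric {M : Type*} [TopologicalSpace M]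
    [ChartedSpace (EuclideanSpace ℝ (Fin 7)) M] (φ : G2Structure M) (x : M)
    (u v : TangentSpace (𝓡 7) x) : ℝ :=
  G2Flow.metric (tangentBasis x) (φ.form x) u v

/-- The dual four-form `ψ = * φ` of a `G₂`-structure. -/
def G2Structure.psi {M : Type*} [TopologicalSpace M]
    [ChartedSpace (EuclideanSpace ℝ (Fin 7)) M] (φ : G2Structure M) (x : M) :
    TangentSpace (𝓡 7) x [⋀^Fin 4]→ₗ[ℝ] ℝ :=
  dualForm (tangentBasis x) (φ.form x)

/-- The component `φ_ijk` in the chart `e`, at the point with coordinates `y`. -/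
def G2Structure.phiComp {M : Type*} [TopologicalSpace M]
    [ChartedSpace (EuclideanSpace ℝ (Fin 7)) M] (φ : G2Structure M)
    (e : OpenPartialHomeomorph M (EuclideanSpace ℝ (Fin 7))) (y : EuclideanSpace ℝ (Fin 7))
    (i j k : Fin 7) : ℝ :=
  φ.form (e.symm y) ![coordFrame e y i, coordFrame e y j, coordFrame e y k]

/-- The component `ψ_ijkl` in the chart `e`, at the point with coordinates `y`. -/
def G2Structure.psiComp {M : Type*} [TopologicalSpace M]
    [ChartedSpace (EuclideanSpace ℝ (Fin 7)) M] (φ : G2Structure M)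
    (e : OpenPartialHomeomorph M (EuclideanSpace ℝ (Fin 7))) (y : EuclideanSpace ℝ (Fin 7))
    (i j k l : Fin 7) : ℝ :=
  φ.psi (e.symm y)
    ![coordFrame e y i, coordFrame e y j, coordFrame e y k, coordFrame e y l]

/-- The matrix `g_ij` in the chart `e`, at the point with coordinates `y`. -/
def G2Structure.metricComp {M : Type*} [TopologicalSpace M]
    [ChartedSpace (EuclideanSpace ℝ (Fin 7)) M] (φ : G2Structure M)
    (e : OpenPartialHomeomorph M (EuclideanSpace ℝ (Fin 7))) (y : EuclideanSpace ℝ (Fin 7)) :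
    Matrix (Fin 7) (Fin 7) ℝ :=
  gram (φ.metric (e.symm y)) (coordFrame e y)

/-- The mixed component `h^l_i = g^{lm} h_{mi}` of a bilinear form `h` in the chart `e`, at the
point with coordinates `y`. -/
def G2Structure.mixedComp {M : Type*} [TopologicalSpace M]
    [ChartedSpace (EuclideanSpace ℝ (Fin 7)) M] (φ : G2Structure M)
    (e : OpenPartialHomeomorph M (EuclideanSpace ℝ (Fin 7))) (y : EuclideanSpace ℝ (Fin 7))
    (h : LinearMap.BilinForm ℝ (TangentSpace (𝓡 7) (e.symm y))) (l i : Fin 7) : ℝ :=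
  ∑ m, (φ.metricComp e y)⁻¹ l m * h (coordFrame e y m) (coordFrame e y i)

/-- The lowered component `X_k = g_{kl} X^l` of a tangent vector `X` in the chart `e`, at the
point with coordinates `y`. -/
def G2Structure.lowerComp {M : Type*} [TopologicalSpace M]
    [ChartedSpace (EuclideanSpace ℝ (Fin 7)) M] (φ : G2Structure M)
    (e : OpenPartialHomeomorph M (EuclideanSpace ℝ (Fin 7))) (y : EuclideanSpace ℝ (Fin 7))
    (X : TangentSpace (𝓡 7) (e.symm y)) (k : Fin 7) : ℝ :=
  ∑ l, φ.metricComp e y k l * coordComponent e y X l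

/-- The general flow equation, in every chart of the smooth structure and for all times `t ∈ J`:
`∂ₜ φ_ijk = h^l_i φ_ljk + h^l_j φ_ilk + h^l_k φ_ijl + X^l ψ_lijk`. -/
def IsGeneralFlow {M : Type*} [TopologicalSpace M]
    [ChartedSpace (EuclideanSpace ℝ (Fin 7)) M] (J : Set ℝ) (φ : ℝ → G2Structure M)
    (h : ℝ → ∀ x : M, LinearMap.BilinForm ℝ (TangentSpace (𝓡 7) x))
    (X : ℝ → ∀ x : M, TangentSpace (𝓡 7) x) : Prop :=
  ∀ t ∈ J, ∀ e ∈ IsManifold.maximalAtlas (𝓡 7) ∞ M, ∀ y ∈ e.target, ∀ i j k : Fin 7,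
    HasDerivWithinAt (fun s => (φ s).phiComp e y i j k)
      (∑ l, ((φ t).mixedComp e y (h t (e.symm y)) l i * (φ t).phiComp e y l j k
        + (φ t).mixedComp e y (h t (e.symm y)) l j * (φ t).phiComp e y i l k
        + (φ t).mixedComp e y (h t (e.symm y)) l k * (φ t).phiComp e y i j l
        + coordComponent e y (X t (e.symm y)) l * (φ t).psiComp e y l i j k)) J t

end G2Flow

end

noncomputable section

namespace G2Flow

/-! The passage from `φ` to `ψ` is natural: by `dualForm_compLinearMap`, the dual of `f^*φ` is
`f^*ψ` for every linear automorphism `f`. Differentiating along `f = id + sA` shows that the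
linearization of `φ ↦ ψ` sends `A · φ` to `A · ψ`, where the endomorphism `A` acts as a derivation.
So once the velocity of `φ` is written as `A · φ`, the velocity of `ψ` is `A · ψ`, and the
variations of the metric and of the volume form never have to be computed.

The `h`-terms already have this shape, with `A` the endomorphism of matrix `h^m_i`. For the
`X`-term, the endomorphism `C = -(1/3) X ×` satisfies `C · φ = X ⌟ ψ` and `C · ψ = -X^♭ ∧ φ`
(`exists_derivation_eq_contraction`). In a basis where `φ` is the model form, these two equations
are contraction identities between integer arrays, verified by evaluation.

The chain rule needs `φ ↦ ψ` to be differentiable at positive forms; this is read off the explicit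
formulas, since `B` is nondegenerate there (`differentiableAt_dualForm`, `det_matrixB_ne_zero`).
`hasDerivWithinAt_dualForm` combines naturality with differentiability. All of this is linear
algebra at one point, and the theorem follows by taking the coordinate frame of the chart as basis.
-/

theorem sum_perm_fin_succ {n : ℕ} (F : Equiv.Perm (Fin (n + 1)) → ℝ) :
    ∑ τ, F τ = ∑ p, ∑ τ, F (Equiv.Perm.decomposeFin.symm (p, τ)) := by
  rw [← Equiv.sum_comp Equiv.Perm.decomposeFin.symm, Fintype.sum_prod_type]

theorem sum_perm_four (G : Fin 4 → Fin 4 → Fin 4 → Fin 4 → ℝ) :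
    ∑ τ : Equiv.Perm (Fin 4), Equiv.Perm.sign τ • G (τ 0) (τ 1) (τ 2) (τ 3) =
      G 0 1 2 3 - G 0 1 3 2 - G 0 2 1 3 + G 0 2 3 1 + G 0 3 1 2 - G 0 3 2 1
      - (G 1 0 2 3 - G 1 0 3 2 - G 1 2 0 3 + G 1 2 3 0 + G 1 3 0 2 - G 1 3 2 0)
      + (G 2 0 1 3 - G 2 0 3 1 - G 2 1 0 3 + G 2 1 3 0 + G 2 3 0 1 - G 2 3 1 0)
      - (G 3 0 1 2 - G 3 0 2 1 - G 3 1 0 2 + G 3 1 2 0 + G 3 2 0 1 - G 3 2 1 0) := by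
  have h : ∀ (p : Fin 4) (q : Fin 3) (r : Fin 2),
      Equiv.Perm.decomposeFin.symm (p, Equiv.Perm.decomposeFin.symm (q,
        Equiv.Perm.decomposeFin.symm (r, (1 : Equiv.Perm (Fin 1))))) =
      Equiv.swap 0 p * Equiv.swap 1 q.succ * Equiv.swap 2 r.succ.succ := by
    decide +kernel
  simp only [sum_perm_fin_succ, Fintype.sum_unique, Equiv.Perm.default_eq, h]
  simp only [Fin.sum_univ_four, Fin.sum_univ_three, Fin.sum_univ_two]
  simp [Equiv.Perm.sign_mul, Equiv.Perm.sign_swap', Equiv.swap_apply_def]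
  ring

/-! ### Derivations, multilinear derivatives and explicit wedge products -/

section Algebra

variable {V : Type*} [AddCommGroup V] [Module ℝ V]

/-- The derivation of alternating forms induced by an endomorphism `A`:
`(A · f)(v₁, …, vₙ) = ∑ᵢ f(v₁, …, A vᵢ, …, vₙ)`. -/
def derivation {n : ℕ} (A : V →ₗ[ℝ] V) (f : V [⋀^Fin (n + 1)]→ₗ[ℝ] ℝ) :
    V [⋀^Fin (n + 1)]→ₗ[ℝ] ℝ :=
  AlternatingMap.alternatizeUncurryFin (f.curryLeft ∘ₗ A)

theorem map_swap_zero_one {n : ℕ} (f : V [⋀^Fin (n + 2)]→ₗ[ℝ] ℝ) (u v : V) (w : Fin n → V) :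
    f (Matrix.vecCons u (Matrix.vecCons v w)) = -f (Matrix.vecCons v (Matrix.vecCons u w)) := by
  rw [← f.map_swap _ (i := 0) (j := 1) (by simp)]
  congr 1
  funext i
  refine Fin.cases rfl (fun i => Fin.cases rfl (fun i => ?_) i) i
  rw [Function.comp_apply, Equiv.swap_apply_of_ne_of_ne]
  · rfl
  · exact Fin.succ_ne_zero _
  · exact fun h => Fin.succ_ne_zero _ (Fin.succ_injective _ h)

theorem map_swap_one_two {n : ℕ} (f : V [⋀^Fin (n + 3)]→ₗ[ℝ] ℝ) (t u v : V) (w : Fin n → V) :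
    f (Matrix.vecCons t (Matrix.vecCons u (Matrix.vecCons v w))) =
      -f (Matrix.vecCons t (Matrix.vecCons v (Matrix.vecCons u w))) :=
  map_swap_zero_one (f.curryLeft t) u v w

theorem map_swap_two_three {n : ℕ} (f : V [⋀^Fin (n + 4)]→ₗ[ℝ] ℝ) (s t u v : V) (w : Fin n → V) :
    f (Matrix.vecCons s (Matrix.vecCons t (Matrix.vecCons u (Matrix.vecCons v w)))) =
      -f (Matrix.vecCons s (Matrix.vecCons t (Matrix.vecCons v (Matrix.vecCons u w)))) :=
  map_swap_one_two (f.curryLeft s) t u v w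

theorem alternatizeUncurryFin_three (F : V →ₗ[ℝ] V [⋀^Fin 2]→ₗ[ℝ] ℝ) (u v w : V) :
    AlternatingMap.alternatizeUncurryFin F ![u, v, w] =
      F u ![v, w] - F v ![u, w] + F w ![u, v] := by
  have h0 : (0 : Fin 3).removeNth ![u, v, w] = ![v, w] := by
    funext i; fin_cases i <;> rfl
  have h1 : (1 : Fin 3).removeNth ![u, v, w] = ![u, w] := by
    funext i; fin_cases i <;> rfl
  have h2 : (2 : Fin 3).removeNth ![u, v, w] = ![u, v] := by
    funext i; fin_cases i <;> rfl
  rw [AlternatingMap.alternatizeUncurryFin_apply, Fin.sum_univ_three, h0, h1, h2]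
  simp [sub_eq_add_neg]

theorem alternatizeUncurryFin_four (F : V →ₗ[ℝ] V [⋀^Fin 3]→ₗ[ℝ] ℝ) (u v w x : V) :
    AlternatingMap.alternatizeUncurryFin F ![u, v, w, x] =
      F u ![v, w, x] - F v ![u, w, x] + F w ![u, v, x] - F x ![u, v, w] := by
  have h0 : (0 : Fin 4).removeNth ![u, v, w, x] = ![v, w, x] := by
    funext i; fin_cases i <;> rfl
  have h1 : (1 : Fin 4).removeNth ![u, v, w, x] = ![u, w, x] := by
    funext i; fin_cases i <;> rfl
  have h2 : (2 : Fin 4).removeNth ![u, v, w, x] = ![u, v, x] := by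
    funext i; fin_cases i <;> rfl
  have h3 : (3 : Fin 4).removeNth ![u, v, w, x] = ![u, v, w] := by
    funext i; fin_cases i <;> rfl
  rw [AlternatingMap.alternatizeUncurryFin_apply, Fin.sum_univ_four, h0, h1, h2, h3]
  simp [sub_eq_add_neg, pow_succ]

/-- Alternatization puts the modified vector in the first slot with a sign; moving it back to its
own slot by transpositions cancels that sign. -/
theorem derivation_three (A : V →ₗ[ℝ] V) (f : V [⋀^Fin 3]→ₗ[ℝ] ℝ) (u v w : V) :
    derivation A f ![u, v, w] = f ![A u, v, w] + f ![u, A v, w] + f ![u, v, A w] := by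
  rw [derivation, alternatizeUncurryFin_three]
  simp only [LinearMap.comp_apply, AlternatingMap.curryLeft_apply_apply]
  rw [map_swap_zero_one f (A v), map_swap_zero_one f (A w), map_swap_one_two f u (A w)]
  ring

theorem derivation_four (A : V →ₗ[ℝ] V) (f : V [⋀^Fin 4]→ₗ[ℝ] ℝ) (u v w x : V) :
    derivation A f ![u, v, w, x] =
      f ![A u, v, w, x] + f ![u, A v, w, x] + f ![u, v, A w, x] + f ![u, v, w, A x] := by
  rw [derivation, alternatizeUncurryFin_four]
  simp only [LinearMap.comp_apply, AlternatingMap.curryLeft_apply_apply]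
  rw [map_swap_zero_one f (A v), map_swap_zero_one f (A w), map_swap_one_two f u (A w),
    map_swap_zero_one f (A x), map_swap_one_two f u (A x), map_swap_two_three f u v (A x)]
  ring

theorem derivation_add_left {n : ℕ} (A B : V →ₗ[ℝ] V) (f : V [⋀^Fin (n + 1)]→ₗ[ℝ] ℝ) :
    derivation (A + B) f = derivation A f + derivation B f := by
  rw [derivation, LinearMap.comp_add, AlternatingMap.alternatizeUncurryFin_add]; rfl

theorem map_three_eq (f : V [⋀^Fin 3]→ₗ[ℝ] ℝ) (u v w : V) :
    f ![u, v, w] = evalAt ![] (((f.curryLeft u).curryLeft v).curryLeft w) := rfl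

theorem map_four_eq (f : V [⋀^Fin 4]→ₗ[ℝ] ℝ) (u v w x : V) :
    f ![u, v, w, x] =
      evalAt ![] ((((f.curryLeft u).curryLeft v).curryLeft w).curryLeft x) := rfl

/-- Linearity in the first slot splits the function as `(u ⌟ f)(r s) + s (u' ⌟ f)(r s)`. At `s = 0`
the derivative `q` is multiplied by zero and drops out. Peeling off one slot at a time in this way
needs no topology on `V`. -/
theorem hasDerivAt_vecCons {n : ℕ} (f : V [⋀^Fin (n + 1)]→ₗ[ℝ] ℝ) (u u' : V) (r : ℝ → Fin n → V)
    {p q : ℝ} (hp : HasDerivAt (fun s => f.curryLeft u (r s)) p 0)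
    (hq : HasDerivAt (fun s => f.curryLeft u' (r s)) q 0) :
    HasDerivAt (fun s : ℝ => f (Matrix.vecCons (u + s • u') (r s)))
      (f (Matrix.vecCons u' (r 0)) + p) 0 := by
  have h := hp.add ((hasDerivAt_id (0 : ℝ)).mul hq)
  refine (h.congr_deriv ?_).congr_of_eventuallyEq (Filter.Eventually.of_forall fun s => ?_)
  · simp [add_comm]
  · simp [← AlternatingMap.curryLeft_apply_apply]

theorem hasDerivAt_map_two (f : V [⋀^Fin 2]→ₗ[ℝ] ℝ) (u v u' v' : V) :
    HasDerivAt (fun s : ℝ => f ![u + s • u', v + s • v']) (f ![u', v] + f ![u, v']) 0 := by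
  have h1 (g : V [⋀^Fin 1]→ₗ[ℝ] ℝ) : HasDerivAt (fun s : ℝ => g ![v + s • v']) (g ![v']) 0 := by
    simpa using hasDerivAt_vecCons g v v' (fun _ => ![]) (hasDerivAt_const _ _)
      (hasDerivAt_const _ _)
  simpa using hasDerivAt_vecCons f u u' (fun s => ![v + s • v']) (h1 _) (h1 _)

theorem hasDerivAt_map_three (f : V [⋀^Fin 3]→ₗ[ℝ] ℝ) (u v w u' v' w' : V) :
    HasDerivAt (fun s : ℝ => f ![u + s • u', v + s • v', w + s • w'])
      (f ![u', v, w] + (f ![u, v', w] + f ![u, v, w'])) 0 := by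
  simpa using hasDerivAt_vecCons f u u' (fun s => ![v + s • v', w + s • w'])
    (hasDerivAt_map_two _ v w v' w') (hasDerivAt_map_two _ v w v' w')

theorem hasDerivAt_map_four (f : V [⋀^Fin 4]→ₗ[ℝ] ℝ) (u v w x u' v' w' x' : V) :
    HasDerivAt (fun s : ℝ => f ![u + s • u', v + s • v', w + s • w', x + s • x'])
      (f ![u', v, w, x] + (f ![u, v', w, x] + (f ![u, v, w', x] + f ![u, v, w, x']))) 0 := by
  simpa using hasDerivAt_vecCons f u u' (fun s => ![v + s • v', w + s • w', x + s • x'])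
    (hasDerivAt_map_three _ v w x v' w' x') (hasDerivAt_map_three _ v w x v' w' x')

/-- An alternating form is determined by its values on increasing tuples of basis vectors. -/
theorem ext_of_strictMono {N : ℕ} {n : ℕ} (b : Basis (Fin N) ℝ V) {f g : V [⋀^Fin n]→ₗ[ℝ] ℝ}
    (h : ∀ m : Fin n → Fin N, StrictMono m → f (fun i => b (m i)) = g (fun i => b (m i))) :
    f = g := by
  -- Only injective tuples remain, and sorting one changes both values by the same sign.
  refine b.ext_alternating fun m hm => ?_
  have h1 := h (m ∘ Tuple.sort m)
    ((Tuple.monotone_sort m).strictMono_of_injective (hm.comp (Tuple.sort m).injective))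
  have h2 : (fun i => b ((m ∘ Tuple.sort m) i)) = (fun i => b (m i)) ∘ Tuple.sort m := rfl
  rw [h2, f.map_perm, g.map_perm] at h1
  exact smul_left_cancel _ h1

theorem ext_three {N : ℕ} (b : Basis (Fin N) ℝ V) {f g : V [⋀^Fin 3]→ₗ[ℝ] ℝ}
    (h : ∀ i j k, i < j → j < k → f ![b i, b j, b k] = g ![b i, b j, b k]) : f = g := by
  refine ext_of_strictMono b fun m hm => ?_
  have h1 : (fun i => b (m i)) = ![b (m 0), b (m 1), b (m 2)] := by
    funext i; fin_cases i <;> rfl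
  rw [h1]
  exact h _ _ _ (hm (by decide)) (hm (by decide))

theorem ext_four {N : ℕ} (b : Basis (Fin N) ℝ V) {f g : V [⋀^Fin 4]→ₗ[ℝ] ℝ}
    (h : ∀ i j k l, i < j → j < k → k < l →
      f ![b i, b j, b k, b l] = g ![b i, b j, b k, b l]) : f = g := by
  refine ext_of_strictMono b fun m hm => ?_
  have h1 : (fun i => b (m i)) = ![b (m 0), b (m 1), b (m 2), b (m 3)] := by
    funext i; fin_cases i <;> rfl
  rw [h1]
  exact h _ _ _ _ (hm (by decide)) (hm (by decide)) (hm (by decide))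

theorem wedge_compLinearMap {W : Type*} [AddCommGroup W] [Module ℝ W] {k l n : ℕ}
    (h : k + l = n) (α : V [⋀^Fin k]→ₗ[ℝ] ℝ) (β : V [⋀^Fin l]→ₗ[ℝ] ℝ) (f : W →ₗ[ℝ] V) :
    wedge h (α.compLinearMap f) (β.compLinearMap f) = (wedge h α β).compLinearMap f := by
  ext v
  simp only [wedge, AlternatingMap.domDomCongr_apply, LinearMap.compAlternatingMap_apply,
    AlternatingMap.domCoprod_apply, AlternatingMap.compLinearMap_apply]
  rw [_root_.sum_apply, _root_.sum_apply]
  congr 1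
  refine Finset.sum_congr rfl fun σ _ => ?_
  induction σ using Quotient.inductionOn' with
  | h σ =>
  rw [AlternatingMap.domCoprod.summand_mk'', AlternatingMap.domCoprod.summand_mk'']
  rfl

/-- The alternatization of the product over all 24 permutations is a multiple of the wedge;
antisymmetry of `α` and `β` groups the 24 terms in fours, one group for each of the six shuffles. -/
theorem wedge_two_two (α β : V [⋀^Fin 2]→ₗ[ℝ] ℝ) (u v w x : V) :
    wedge (show 2 + 2 = 4 from rfl) α β ![u, v, w, x] =
      α ![u, v] * β ![w, x] - α ![u, w] * β ![v, x] + α ![u, x] * β ![v, w]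
      + α ![v, w] * β ![u, x] - α ![v, x] * β ![u, w] + α ![w, x] * β ![u, v] := by
  have hα : ∀ v w, α ![v, w] = -α ![w, v] := fun v w => map_swap_zero_one α v w ![]
  have hβ : ∀ v w, β ![v, w] = -β ![w, v] := fun v w => map_swap_zero_one β v w ![]
  set z := ![u, v, w, x] with hz
  have h := congrArg (fun F => LinearMap.mul' ℝ ℝ (F (z ∘ finSumFinEquiv)))
    (MultilinearMap.domCoprod_alternization_eq α β)
  -- The factor is `4 = 2! · 2!`.
  have h4 : LinearMap.mul' ℝ ℝ ((((Fintype.card (Fin 2)).factorial *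
      (Fintype.card (Fin 2)).factorial) • α.domCoprod β) (z ∘ finSumFinEquiv)) =
      4 * wedge (show 2 + 2 = 4 from rfl) α β z := by
    rw [AlternatingMap.smul_apply, LinearMap.map_smul_of_tower, Fintype.card_fin, nsmul_eq_mul]
    congr 1
  have hs : ∀ σ : Equiv.Perm (Fin 4),
      Equiv.Perm.sign ((finSumFinEquiv (m := 2) (n := 2)).symm.permCongr σ) =
      Equiv.Perm.sign σ := fun σ => Equiv.Perm.sign_permCongr _ _
  have ht : ∀ σ : Equiv.Perm (Fin 4), LinearMap.mul' ℝ ℝ (((MultilinearMap.domCoprod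
      α.toMultilinearMap β.toMultilinearMap).domDomCongr
        ((finSumFinEquiv (m := 2) (n := 2)).symm.permCongr σ))
        (z ∘ finSumFinEquiv)) = α ![z (σ 0), z (σ 1)] * β ![z (σ 2), z (σ 3)] := fun σ => by
    have h1 : (fun i => (z ∘ finSumFinEquiv)
        ((finSumFinEquiv (m := 2) (n := 2)).symm.permCongr σ (Sum.inl i))) =
        ![z (σ 0), z (σ 1)] := by
      funext i; fin_cases i <;> simp [Equiv.permCongr_apply] <;> rfl
    have h2 : (fun i => (z ∘ finSumFinEquiv)
        ((finSumFinEquiv (m := 2) (n := 2)).symm.permCongr σ (Sum.inr i))) =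
        ![z (σ 2), z (σ 3)] := by
      funext i; fin_cases i <;> simp [Equiv.permCongr_apply] <;> rfl
    rw [← h1, ← h2]
    rfl
  rw [h4, MultilinearMap.alternatization_apply, map_sum,
    ← Equiv.sum_comp (finSumFinEquiv (m := 2) (n := 2)).symm.permCongr] at h
  simp only [LinearMap.map_smul_of_tower, hs] at h
  rw [Finset.sum_congr rfl fun σ _ => congrArg (Equiv.Perm.sign σ • ·) (ht σ),
    sum_perm_four fun i j k l => α ![z i, z j] * β ![z k, z l]] at h
  simp only [hz, Matrix.cons_val] at h ⊢
  rw [hα v u, hα w u, hα x u, hα w v, hα x v, hα x w, hβ v u, hβ w u, hβ x u, hβ w v, hβ x v,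
    hβ x w] at h
  linarith

end Algebra

/-! ### Integer identities for the model form and its dual -/

section Model

/-- The coefficient of `eᵖ ∧ e^q ∧ eʳ`, with `p, q, r` distinct, on the basis vectors with
indices `i, j, k`. -/
def tripleCoeff (p q r i j k : Fin 7) : ℤ :=
  if p = i then
    if q = j then if r = k then 1 else 0
    else if q = k then if r = j then -1 else 0 else 0
  else if p = j then
    if q = i then if r = k then -1 else 0
    else if q = k then if r = i then 1 else 0 else 0
  else if p = k then
    if q = i then if r = j then 1 else 0
    else if q = j then if r = i then -1 else 0 else 0
  else 0

/-- The coefficient of `eᵖ ∧ e^q ∧ eʳ ∧ eˢ`, with `p, q, r, s` distinct, on the basis vectors with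
indices `i, j, k, l`. -/
def quadCoeff (p q r s i j k l : Fin 7) : ℤ :=
  (if p = i then tripleCoeff q r s j k l else 0) - (if p = j then tripleCoeff q r s i k l else 0)
  + (if p = k then tripleCoeff q r s i j l else 0) - (if p = l then tripleCoeff q r s i j k else 0)

/-- The components of the model three-form. -/
def phiCoeff (i j k : Fin 7) : ℤ :=
  tripleCoeff 0 1 2 i j k + tripleCoeff 0 3 4 i j k + tripleCoeff 0 5 6 i j k
    + tripleCoeff 1 3 5 i j k - tripleCoeff 1 4 6 i j k - tripleCoeff 2 3 6 i j k
    - tripleCoeff 2 4 5 i j k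

/-- The components of the dual of the model three-form. -/
def psiCoeff (i j k l : Fin 7) : ℤ :=
  -quadCoeff 3 4 5 6 i j k l - quadCoeff 1 2 5 6 i j k l - quadCoeff 1 2 3 4 i j k l
    - quadCoeff 0 2 4 6 i j k l + quadCoeff 0 2 3 5 i j k l + quadCoeff 0 1 4 5 i j k l
    + quadCoeff 0 1 3 6 i j k l

/-- This is the alternated form of `φ_{xim} φ_{jkm} = δ_{xj} δ_{ik} - δ_{xk} δ_{ij} - ψ_{xijk}`: the
`δ`-terms cancel and each product contributes one `-ψ`. The resulting `-3` is the origin of the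
factor `-1/3` in `crossEnd`. -/
theorem sum_phiCoeff_mul_phiCoeff : ∀ x i j k : Fin 7, i < j → j < k →
    ∑ m, (phiCoeff x i m * phiCoeff m j k - phiCoeff x j m * phiCoeff m i k
      + phiCoeff x k m * phiCoeff m i j) = -3 * psiCoeff x i j k := by
  decide +kernel

/-- The alternated contraction of `φ` with `ψ` is three times `eˣ ∧ φ`, so the same factor `-1/3`
produces `-eˣ ∧ φ`. -/
theorem sum_phiCoeff_mul_psiCoeff : ∀ x i j k l : Fin 7, i < j → j < k → k < l →
    ∑ m, (phiCoeff x i m * psiCoeff m j k l - phiCoeff x j m * psiCoeff m i k l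
      + phiCoeff x k m * psiCoeff m i j l - phiCoeff x l m * psiCoeff m i j k) =
    3 * ((if x = i then phiCoeff j k l else 0) - (if x = j then phiCoeff i k l else 0)
      + (if x = k then phiCoeff i j l else 0) - (if x = l then phiCoeff i j k else 0)) := by
  decide +kernel

/-- The Levi-Civita symbol in dimension seven. -/
def leviCivita (f : Fin 7 → Fin 7) : ℤ :=
  ∏ i, ∏ j ∈ Finset.Ioi i, if f i < f j then 1 else if f j < f i then -1 else 0

/-- The left side is the star of the model form for the volume form `b.det`. The sign on the right
is there because the orientation determined by the model form is the opposite one. -/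
theorem sum_leviCivita : ∀ i j k l : Fin 7, i < j → j < k → k < l →
    leviCivita ![0, 1, 2, i, j, k, l] + leviCivita ![0, 3, 4, i, j, k, l]
      + leviCivita ![0, 5, 6, i, j, k, l] + leviCivita ![1, 3, 5, i, j, k, l]
      - leviCivita ![1, 4, 6, i, j, k, l] - leviCivita ![2, 3, 6, i, j, k, l]
      - leviCivita ![2, 4, 5, i, j, k, l] = -psiCoeff i j k l := by
  decide +kernel

/-- The components of `(u ⌟ φ) ∧ (v ⌟ φ)`, where `φ` is the model three-form and `u`, `v` are the
basis vectors with indices `x`, `y`. -/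
def squareCoeff (x y i j k l : Fin 7) : ℤ :=
  phiCoeff x i j * phiCoeff y k l - phiCoeff x i k * phiCoeff y j l
    + phiCoeff x i l * phiCoeff y j k + phiCoeff x j k * phiCoeff y i l
    - phiCoeff x j l * phiCoeff y i k + phiCoeff x k l * phiCoeff y i j

/-- Each quadruple is the complement of one monomial of the model form and carries that monomial's
sign, so the left side is the top coefficient of `(b_x ⌟ φ) ∧ (b_y ⌟ φ) ∧ φ`. -/
theorem sum_squareCoeff : ∀ x y : Fin 7,
    squareCoeff x y 3 4 5 6 + squareCoeff x y 1 2 5 6 + squareCoeff x y 1 2 3 4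
      + squareCoeff x y 0 2 4 6 - squareCoeff x y 0 2 3 5 - squareCoeff x y 0 1 4 5
      - squareCoeff x y 0 1 3 6 = if x = y then 6 else 0 := by
  decide +kernel

end Model

/-! ### Metric, volume form and dual form of the model form -/

section Model

variable {V : Type*} [AddCommGroup V] [Module ℝ V]

/-- This ties the product over pairs, which the kernel can evaluate on explicit tuples, to the sign
by which alternating maps transform. -/
theorem leviCivita_perm (σ : Equiv.Perm (Fin 7)) : leviCivita σ = Equiv.Perm.sign σ := by
  rw [Equiv.Perm.sign_eq_prod_prod_Ioi, leviCivita]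
  push_cast
  refine Finset.prod_congr rfl fun i _ => Finset.prod_congr rfl fun j hj => ?_
  have hne : σ i ≠ σ j := fun h => (Finset.mem_Ioi.1 hj).ne (σ.injective h)
  split_ifs with h1 h2
  · rfl
  · rfl
  · exact absurd (le_antisymm (not_lt.1 h2) (not_lt.1 h1)) hne

theorem leviCivita_eq_zero {f : Fin 7 → Fin 7} {i j : Fin 7} (hij : i ≠ j) (h : f i = f j) :
    leviCivita f = 0 := by
  wlog hlt : i < j generalizing i j
  · exact this hij.symm h.symm (lt_of_le_of_ne (not_lt.1 hlt) hij.symm)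
  refine Finset.prod_eq_zero (Finset.mem_univ i)
    (Finset.prod_eq_zero (Finset.mem_Ioi.2 hlt) ?_)
  simp [h]

theorem map_basis_eq_leviCivita (F : V [⋀^Fin 7]→ₗ[ℝ] ℝ) (b : Fin 7 → V) (f : Fin 7 → Fin 7) :
    F (fun i => b (f i)) = leviCivita f * F b := by
  by_cases hf : Function.Injective f
  · obtain ⟨σ, rfl⟩ : ∃ σ : Equiv.Perm (Fin 7), (σ : Fin 7 → Fin 7) = f :=
      ⟨Equiv.ofBijective f (Finite.injective_iff_bijective.1 hf), rfl⟩
    rw [leviCivita_perm]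
    exact (F.map_perm b σ).trans (by simp [Units.smul_def])
  · obtain ⟨i, j, h, hij⟩ : ∃ i j, f i = f j ∧ i ≠ j := by
      simpa [Function.Injective] using hf
    rw [leviCivita_eq_zero hij h, F.map_eq_zero_of_eq _ (by simp [h]) hij]
    simp

theorem dualTriple_apply (b : Basis (Fin 7) ℝ V) (p q r : Fin 7) (u v w : V) :
    dualTriple b p q r ![u, v, w] =
      b.coord p u * b.coord q v * b.coord r w - b.coord p u * b.coord r v * b.coord q w
      - b.coord q u * b.coord p v * b.coord r w + b.coord q u * b.coord r v * b.coord p w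
      + b.coord r u * b.coord p v * b.coord q w - b.coord r u * b.coord q v * b.coord p w := by
  simp only [dualTriple, AlternatingMap.compLinearMap_apply]
  exact (Matrix.det_fin_three _).trans (by simp)

theorem dualTriple_basis (b : Basis (Fin 7) ℝ V) {p q r : Fin 7} (hpq : p ≠ q) (hpr : p ≠ r)
    (hqr : q ≠ r) (i j k : Fin 7) :
    dualTriple b p q r ![b i, b j, b k] = tripleCoeff p q r i j k := by
  rw [dualTriple_apply]
  simp only [Basis.coord_apply, Basis.repr_self, Finsupp.single_apply, tripleCoeff,
    eq_comm (b := p), eq_comm (b := q), eq_comm (b := r)]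
  split_ifs <;> simp_all

/-- The decomposable four-form `eᵖ ∧ e^q ∧ eʳ ∧ eˢ` built from the basis dual to `b`. -/
def dualQuad (b : Basis (Fin 7) ℝ V) (p q r s : Fin 7) : V [⋀^Fin 4]→ₗ[ℝ] ℝ :=
  AlternatingMap.alternatizeUncurryFin ((b.coord p).smulRight (dualTriple b q r s))

theorem dualQuad_basis (b : Basis (Fin 7) ℝ V) {p q r s : Fin 7} (hqr : q ≠ r) (hqs : q ≠ s)
    (hrs : r ≠ s) (i j k l : Fin 7) :
    dualQuad b p q r s ![b i, b j, b k, b l] = quadCoeff p q r s i j k l := by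
  rw [dualQuad, alternatizeUncurryFin_four]
  simp only [LinearMap.smulRight_apply, AlternatingMap.smul_apply,
    dualTriple_basis b hqr hqs hrs]
  simp [quadCoeff, Finsupp.single_apply, eq_comm (b := p)]

theorem modelForm_basis (b : Basis (Fin 7) ℝ V) (i j k : Fin 7) :
    modelForm b ![b i, b j, b k] = phiCoeff i j k := by
  simp [modelForm, phiCoeff, dualTriple_basis]

/-- The dual of the model three-form. -/
def modelDual (b : Basis (Fin 7) ℝ V) : V [⋀^Fin 4]→ₗ[ℝ] ℝ :=
  -dualQuad b 3 4 5 6 - dualQuad b 1 2 5 6 - dualQuad b 1 2 3 4 - dualQuad b 0 2 4 6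
    + dualQuad b 0 2 3 5 + dualQuad b 0 1 4 5 + dualQuad b 0 1 3 6

theorem modelDual_basis (b : Basis (Fin 7) ℝ V) (i j k l : Fin 7) :
    modelDual b ![b i, b j, b k, b l] = psiCoeff i j k l := by
  simp [modelDual, psiCoeff, dualQuad_basis]

/-- Only the trivial shuffle survives: any other feeds one of the first four basis vectors to the
triple, whose determinant then has a zero row. -/
theorem wedge_dualTriple (b : Basis (Fin 7) ℝ V) (γ : V [⋀^Fin 4]→ₗ[ℝ] ℝ) (f : Fin 7 → Fin 7)
    (hf : Function.Injective f) :
    wedge (show 4 + 3 = 7 from rfl) γ (dualTriple b (f 4) (f 5) (f 6)) (fun i => b (f i)) =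
      γ ![b (f 0), b (f 1), b (f 2), b (f 3)] := by
  rw [wedge_eq_single]
  · have h1 : (fun i : Fin 4 => b (f (finCongr (show 4 + 3 = 7 from rfl)
        (finSumFinEquiv (Sum.inl i))))) = ![b (f 0), b (f 1), b (f 2), b (f 3)] := by
      funext i; fin_cases i <;> rfl
    have h2 : (fun i : Fin 3 => b (f (finCongr (show 4 + 3 = 7 from rfl)
        (finSumFinEquiv (Sum.inr i))))) = ![b (f 4), b (f 5), b (f 6)] := by
      funext i; fin_cases i <;> rfl
    rw [h1, h2, dualTriple_basis b (hf.ne (by decide)) (hf.ne (by decide)) (hf.ne (by decide))]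
    simp [tripleCoeff]
  · intro σ x y hxy
    refine Matrix.det_eq_zero_of_row_eq_zero x fun c => ?_
    rw [LinearMap.pi_apply]
    dsimp only
    rw [hxy]
    have hne : ∀ m : Fin 3, f (finCongr (show 4 + 3 = 7 from rfl) (finSumFinEquiv (Sum.inl y))) ≠
        f (Fin.natAdd 4 m) := by
      refine fun m => hf.ne fun h => ?_
      have h3 : (y : ℕ) = 4 + (m : ℕ) := congrArg Fin.val h
      omega
    fin_cases c
    · simpa [Finsupp.single_apply] using hne 0
    · simpa [Finsupp.single_apply] using hne 1
    · simpa [Finsupp.single_apply] using hne 2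

theorem wedge_dualTriple_basis (b : Basis (Fin 7) ℝ V) (γ : V [⋀^Fin 4]→ₗ[ℝ] ℝ)
    (f : Fin 7 → Fin 7) (hf : leviCivita f = 1) :
    wedge (show 4 + 3 = 7 from rfl) γ (dualTriple b (f 4) (f 5) (f 6)) b =
      γ ![b (f 0), b (f 1), b (f 2), b (f 3)] := by
  have hinj : Function.Injective f := fun i j h => by
    by_contra hij
    rw [leviCivita_eq_zero hij h] at hf
    exact zero_ne_one hf
  rw [← wedge_dualTriple b γ f hinj, map_basis_eq_leviCivita _ b f, hf, Int.cast_one, one_mul]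

/-- Wedging with a monomial reads off the component on the complementary indices. Each complement is
listed in the order that makes the full arrangement an even permutation, so no further signs enter.
-/
theorem topForm_modelForm (b : Basis (Fin 7) ℝ V) (x y : Fin 7) :
    topForm (modelForm b) (b x) (b y) b = if x = y then 6 else 0 := by
  have h012 (γ : V [⋀^Fin 4]→ₗ[ℝ] ℝ) :=
    wedge_dualTriple_basis b γ ![3, 4, 5, 6, 0, 1, 2] (by decide +kernel)
  have h034 (γ : V [⋀^Fin 4]→ₗ[ℝ] ℝ) :=
    wedge_dualTriple_basis b γ ![1, 2, 5, 6, 0, 3, 4] (by decide +kernel)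
  have h056 (γ : V [⋀^Fin 4]→ₗ[ℝ] ℝ) :=
    wedge_dualTriple_basis b γ ![1, 2, 3, 4, 0, 5, 6] (by decide +kernel)
  have h135 (γ : V [⋀^Fin 4]→ₗ[ℝ] ℝ) :=
    wedge_dualTriple_basis b γ ![0, 2, 4, 6, 1, 3, 5] (by decide +kernel)
  have h146 (γ : V [⋀^Fin 4]→ₗ[ℝ] ℝ) :=
    wedge_dualTriple_basis b γ ![0, 2, 3, 5, 1, 4, 6] (by decide +kernel)
  have h236 (γ : V [⋀^Fin 4]→ₗ[ℝ] ℝ) :=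
    wedge_dualTriple_basis b γ ![0, 1, 4, 5, 2, 3, 6] (by decide +kernel)
  have h245 (γ : V [⋀^Fin 4]→ₗ[ℝ] ℝ) :=
    wedge_dualTriple_basis b γ ![0, 1, 3, 6, 2, 4, 5] (by decide +kernel)
  simp only [Matrix.cons_val] at h012 h034 h056 h135 h146 h236 h245
  have hw (γ : V [⋀^Fin 4]→ₗ[ℝ] ℝ) : wedge (show 4 + 3 = 7 from rfl) γ (modelForm b) b =
      γ ![b 3, b 4, b 5, b 6] + γ ![b 1, b 2, b 5, b 6] + γ ![b 1, b 2, b 3, b 4]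
      + γ ![b 0, b 2, b 4, b 6] - γ ![b 0, b 2, b 3, b 5] - γ ![b 0, b 1, b 4, b 5]
      - γ ![b 0, b 1, b 3, b 6] := by
    rw [← wedgeHom_apply, modelForm, ← evalAt_apply]
    simp only [map_add, map_sub]
    simp only [evalAt_apply, wedgeHom_apply, h012, h034, h056, h135, h146, h236, h245]
  have h4 (i j k l : Fin 7) : wedge (show 2 + 2 = 4 from rfl) ((modelForm b).curryLeft (b x))
      ((modelForm b).curryLeft (b y)) ![b i, b j, b k, b l] = squareCoeff x y i j k l := by
    rw [wedge_two_two]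
    simp only [AlternatingMap.curryLeft_apply_apply, modelForm_basis, squareCoeff]
    push_cast
    rfl
  have h := congrArg (Int.cast (R := ℝ)) (sum_squareCoeff x y)
  push_cast at h
  rw [topForm, hw]
  simp only [h4, h]

theorem matrixB_modelForm (b : Basis (Fin 7) ℝ V) :
    matrixB b (modelForm b) = (6 : ℝ) • (1 : Matrix (Fin 7) (Fin 7) ℝ) := by
  ext i j
  rw [matrixB_apply, topForm_modelForm, Matrix.smul_apply, Matrix.one_apply]
  simp

theorem ninthRoot_det_modelForm (b : Basis (Fin 7) ℝ V) :
    ninthRoot (matrixB b (modelForm b)).det = (6 : ℝ) ^ (7 / 9 : ℝ) := by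
  rw [matrixB_modelForm, Matrix.det_smul, Matrix.det_one, mul_one, Fintype.card_fin, ninthRoot,
    Real.sign_of_pos (by positivity), one_mul, abs_of_pos (by positivity), ← Real.rpow_natCast,
    ← Real.rpow_mul (by norm_num)]
  norm_num

/-- The powers of 6 cancel because `-2/9 + 1 = 7/9`; the adapted basis is orthonormal. -/
theorem metric_modelForm_basis (b : Basis (Fin 7) ℝ V) (i j : Fin 7) :
    metric b (modelForm b) (b i) (b j) = if i = j then 1 else 0 := by
  rw [metric, topForm_modelForm, ninthRoot_det_modelForm]
  split_ifs
  · rw [← mul_div_assoc, div_eq_one_iff_eq (by positivity)]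
    nth_rewrite 2 [← Real.rpow_one 6]
    rw [← Real.rpow_add (by norm_num)]
    norm_num
  · simp

theorem metric_modelForm (b : Basis (Fin 7) ℝ V) (u v : V) :
    metric b (modelForm b) u v = ∑ a, b.coord a u * b.coord a v := by
  have h : metric b (modelForm b) (∑ i, b.repr u i • b i) (∑ j, b.repr v j • b j) =
      ∑ i, ∑ j, b.repr u i * b.repr v j * metric b (modelForm b) (b i) (b j) := by
    simp only [metric, topForm_sum_apply, Finset.sum_div, Finset.mul_sum]
    refine Finset.sum_congr rfl fun _ _ => Finset.sum_congr rfl fun _ _ => by ring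
  rw [b.sum_repr, b.sum_repr] at h
  simpa [metric_modelForm_basis] using h

theorem volumeForm_modelForm (b : Basis (Fin 7) ℝ V) :
    volumeForm b (modelForm b) = -b.det := by
  rw [volumeForm, ninthRoot_det_modelForm, ← Real.rpow_add (by norm_num)]
  ext v
  rw [AlternatingMap.smul_apply, AlternatingMap.neg_apply]
  norm_num

theorem raised_modelForm (b : Basis (Fin 7) ℝ V) (a : Fin 7) :
    raised (metric b (modelForm b)) b a = b a := by
  have : gram (metric b (modelForm b)) b = 1 := by
    ext i j
    rw [gram, metric_modelForm_basis, Matrix.one_apply]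
  simp [raised, this, Matrix.one_apply]

theorem hodgeStar_apply (b : Fin 7 → V) (g : V → V → ℝ) (vol : V [⋀^Fin 7]→ₗ[ℝ] ℝ)
    (β : V [⋀^Fin 3]→ₗ[ℝ] ℝ) (v : Fin 4 → V) :
    hodgeStar g vol b β v = 1 / 6 * ∑ i, ∑ j, ∑ k, β ![b i, b j, b k] *
      vol (Matrix.vecCons (raised g b i) (Matrix.vecCons (raised g b j)
        (Matrix.vecCons (raised g b k) v))) := by
  rw [← evalAt_apply, hodgeStar]
  simp only [map_smul, map_sum, evalAt_apply, AlternatingMap.curryLeft_apply_apply, smul_eq_mul]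

/-- The six terms of the determinant give equal contributions by antisymmetry of `vol`, which
absorbs the factor `1/6`. -/
theorem hodgeStar_dualTriple (b : Basis (Fin 7) ℝ V) (g : V → V → ℝ) (vol : V [⋀^Fin 7]→ₗ[ℝ] ℝ)
    (hg : ∀ a, raised g b a = b a) (p q r : Fin 7) (v : Fin 4 → V) :
    hodgeStar g vol b (dualTriple b p q r) v =
      vol (Matrix.vecCons (b p) (Matrix.vecCons (b q) (Matrix.vecCons (b r) v))) := by
  have h01 (i j k : Fin 7) := map_swap_zero_one vol (b i) (b j) (Matrix.vecCons (b k) v)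
  have h12 (i j k : Fin 7) := map_swap_one_two vol (b i) (b j) (b k) v
  rw [hodgeStar_apply]
  simp only [hg]
  generalize hC : (fun i j k : Fin 7 => vol (Matrix.vecCons (b i) (Matrix.vecCons (b j)
    (Matrix.vecCons (b k) v)))) = C
  have hC' (i j k : Fin 7) : vol (Matrix.vecCons (b i) (Matrix.vecCons (b j)
    (Matrix.vecCons (b k) v))) = C i j k := by rw [← hC]
  simp only [hC'] at h01 h12 ⊢
  simp only [dualTriple_apply, Basis.coord_apply, Basis.repr_self, Finsupp.single_apply, sub_mul,
    add_mul, Finset.sum_add_distrib, Finset.sum_sub_distrib, mul_ite, mul_one, mul_zero,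
    Finset.sum_ite_eq', Finset.mem_univ, if_true, ite_mul, zero_mul, one_mul]
  rw [h12 p r q, h01 q p r, h12 q r p, h01 q p r, h01 r p q, h12 p r q, h12 r q p, h01 r p q,
    h12 p r q]
  ring

theorem hodgeStar_add (b : Fin 7 → V) (g : V → V → ℝ) (vol : V [⋀^Fin 7]→ₗ[ℝ] ℝ)
    (α β : V [⋀^Fin 3]→ₗ[ℝ] ℝ) :
    hodgeStar g vol b (α + β) = hodgeStar g vol b α + hodgeStar g vol b β := by
  ext v
  rw [AlternatingMap.add_apply]
  simp only [hodgeStar_apply, AlternatingMap.add_apply, add_mul, Finset.sum_add_distrib, mul_add]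

theorem hodgeStar_sub (b : Fin 7 → V) (g : V → V → ℝ) (vol : V [⋀^Fin 7]→ₗ[ℝ] ℝ)
    (α β : V [⋀^Fin 3]→ₗ[ℝ] ℝ) :
    hodgeStar g vol b (α - β) = hodgeStar g vol b α - hodgeStar g vol b β := by
  ext v
  rw [AlternatingMap.sub_apply]
  simp only [hodgeStar_apply, AlternatingMap.sub_apply, sub_mul, Finset.sum_sub_distrib, mul_sub]

theorem dualForm_modelForm (b : Basis (Fin 7) ℝ V) : dualForm b (modelForm b) = modelDual b := by
  refine ext_four b fun i j k l hij hjk hkl => ?_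
  have hc (p q r : Fin 7) : hodgeStar (metric b (modelForm b)) (volumeForm b (modelForm b)) b
      (dualTriple b p q r) ![b i, b j, b k, b l] = -leviCivita ![p, q, r, i, j, k, l] := by
    have hv : ![b p, b q, b r, b i, b j, b k, b l] = fun m => b (![p, q, r, i, j, k, l] m) := by
      funext m; fin_cases m <;> rfl
    rw [hodgeStar_dualTriple b _ _ (raised_modelForm b), volumeForm_modelForm]
    rw [AlternatingMap.neg_apply, hv, map_basis_eq_leviCivita, Basis.det_self, mul_one]
  have hm : dualForm b (modelForm b) = hodgeStar (metric b (modelForm b))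
      (volumeForm b (modelForm b)) b (dualTriple b 0 1 2 + dualTriple b 0 3 4 + dualTriple b 0 5 6
        + dualTriple b 1 3 5 - dualTriple b 1 4 6 - dualTriple b 2 3 6 - dualTriple b 2 4 5) := rfl
  have h := congrArg (Int.cast (R := ℝ)) (sum_leviCivita i j k l hij hjk hkl)
  push_cast at h
  rw [hm, modelDual_basis]
  simp only [hodgeStar_add, hodgeStar_sub, AlternatingMap.add_apply, AlternatingMap.sub_apply, hc]
  linarith

end Model

/-! ### The `X`-term as an infinitesimal change of basis -/

section Cross

variable {V : Type*} [AddCommGroup V] [Module ℝ V]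

/-- The endomorphism `u ↦ -(1/3) X × u`, where `×` is the cross product of the model three-form in
the basis `b`. -/
def crossEnd (b : Basis (Fin 7) ℝ V) (X : V) : V →ₗ[ℝ] V :=
  Matrix.toLin b b (Matrix.of fun m i => -(1 / 3) * ∑ a, b.repr X a * phiCoeff a i m)

theorem crossEnd_contract {n : ℕ} (b : Basis (Fin 7) ℝ V) (X : V) (i : Fin 7)
    (f : V [⋀^Fin (n + 1)]→ₗ[ℝ] ℝ) (v : Fin n → V) :
    f.curryLeft (crossEnd b X (b i)) v =
      -(1 / 3) * ∑ a, b.repr X a * ∑ m, phiCoeff a i m * f (Matrix.vecCons (b m) v) := by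
  rw [crossEnd, Matrix.toLin_self, ← evalAt_apply]
  simp only [map_sum, map_smul, smul_eq_mul, Finset.mul_sum, Finset.sum_mul, Matrix.of_apply,
    evalAt_apply, AlternatingMap.curryLeft_apply_apply]
  rw [Finset.sum_comm]
  refine Finset.sum_congr rfl fun _ _ => Finset.sum_congr rfl fun _ _ => by ring

theorem map_vecCons_eq_sum {n : ℕ} (b : Basis (Fin 7) ℝ V) (X : V)
    (f : V [⋀^Fin (n + 1)]→ₗ[ℝ] ℝ) (v : Fin n → V) :
    f (Matrix.vecCons X v) = ∑ a, b.repr X a * f (Matrix.vecCons (b a) v) := by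
  conv_lhs => rw [← AlternatingMap.curryLeft_apply_apply, ← b.sum_repr X, ← evalAt_apply]
  simp only [map_sum, map_smul, smul_eq_mul, evalAt_apply, AlternatingMap.curryLeft_apply_apply]

theorem crossEnd_contract_modelForm (b : Basis (Fin 7) ℝ V) (X : V) (i j k : Fin 7) :
    (modelForm b).curryLeft (crossEnd b X (b i)) ![b j, b k] =
      -(1 / 3) * ∑ a, b.repr X a * ∑ m, (phiCoeff a i m : ℝ) * phiCoeff m j k := by
  simp only [← modelForm_basis b _ j k]
  exact crossEnd_contract b X i _ _

theorem crossEnd_contract_modelDual (b : Basis (Fin 7) ℝ V) (X : V) (i j k l : Fin 7) :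
    (modelDual b).curryLeft (crossEnd b X (b i)) ![b j, b k, b l] =
      -(1 / 3) * ∑ a, b.repr X a * ∑ m, (phiCoeff a i m : ℝ) * psiCoeff m j k l := by
  simp only [← modelDual_basis b _ j k l]
  exact crossEnd_contract b X i _ _

theorem modelDual_curryLeft_basis (b : Basis (Fin 7) ℝ V) (X : V) (i j k : Fin 7) :
    (modelDual b).curryLeft X ![b i, b j, b k] = ∑ a, b.repr X a * psiCoeff a i j k := by
  simp only [← modelDual_basis b _ i j k]
  exact map_vecCons_eq_sum b X (modelDual b) ![b i, b j, b k]

/-- Both sides are linear in `X`; comparing the coefficients of each coordinate leaves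
`sum_phiCoeff_mul_phiCoeff`. -/
theorem derivation_crossEnd_modelForm (b : Basis (Fin 7) ℝ V) (X : V) :
    derivation (crossEnd b X) (modelForm b) = (modelDual b).curryLeft X := by
  refine ext_three b fun i j k hij hjk => ?_
  have h (x : Fin 7) := congrArg (Int.cast (R := ℝ)) (sum_phiCoeff_mul_phiCoeff x i j k hij hjk)
  push_cast [Finset.sum_add_distrib, Finset.sum_sub_distrib] at h
  rw [derivation, alternatizeUncurryFin_three]
  simp only [LinearMap.comp_apply, crossEnd_contract_modelForm, modelDual_curryLeft_basis]
  rw [← mul_sub, ← mul_add, ← Finset.sum_sub_distrib, ← Finset.sum_add_distrib, Finset.mul_sum]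
  refine Finset.sum_congr rfl fun a _ => ?_
  linear_combination -(1 / 3) * b.repr X a * h a

/-- Since `b` is orthonormal for the model metric, the covector on the right is `X^♭` and its
alternatized product with the form is `X^♭ ∧ φ`. Coefficientwise the claim is
`sum_phiCoeff_mul_psiCoeff`. -/
theorem derivation_crossEnd_modelDual (b : Basis (Fin 7) ℝ V) (X : V) :
    derivation (crossEnd b X) (modelDual b) = -AlternatingMap.alternatizeUncurryFin
      ((∑ a, b.repr X a • b.coord a).smulRight (modelForm b)) := by
  refine ext_four b fun i j k l hij hjk hkl => ?_
  have h (x : Fin 7) :=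
    congrArg (Int.cast (R := ℝ)) (sum_phiCoeff_mul_psiCoeff x i j k l hij hjk hkl)
  push_cast [Finset.sum_add_distrib, Finset.sum_sub_distrib] at h
  have hX (i : Fin 7) (c : ℝ) : (∑ a, b.repr X a • b.coord a) (b i) * c =
      ∑ a, b.repr X a * if a = i then c else 0 := by
    simp [LinearMap.sum_apply, Finsupp.single_apply]
  rw [derivation, AlternatingMap.neg_apply, alternatizeUncurryFin_four, alternatizeUncurryFin_four]
  simp only [LinearMap.comp_apply, crossEnd_contract_modelDual,
    LinearMap.smulRight_apply, AlternatingMap.smul_apply, modelForm_basis, smul_eq_mul, hX]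
  simp only [← mul_sub, ← mul_add, ← Finset.sum_sub_distrib, ← Finset.sum_add_distrib,
    Finset.mul_sum, ← Finset.sum_neg_distrib]
  refine Finset.sum_congr rfl fun a _ => ?_
  simp only [← Finset.mul_sum, Finset.sum_add_distrib, Finset.sum_sub_distrib] at h ⊢
  linear_combination -(1 / 3) * b.repr X a * h a

/-- For a positive three-form `φ` with dual form `ψ`, there is an endomorphism `A` with
`A · φ = X ⌟ ψ` and `A · ψ = -X^♭ ∧ φ`. -/
theorem exists_derivation_eq_contraction (b : Basis (Fin 7) ℝ V) {φ : V [⋀^Fin 3]→ₗ[ℝ] ℝ}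
    (hφ : IsPositive φ) (X : V) : ∃ A : V →ₗ[ℝ] V,
      derivation A φ = (dualForm b φ).curryLeft X ∧
      ∀ u v w x, derivation A (dualForm b φ) ![u, v, w, x] =
        -metric b φ u X * φ ![v, w, x] + metric b φ v X * φ ![u, w, x]
          - metric b φ w X * φ ![u, v, x] + metric b φ x X * φ ![u, v, w] := by
  obtain ⟨b', rfl⟩ := hφ
  -- Metric and dual form may be computed in the adapted basis `b'`, whatever `b` is.
  rw [dualForm_eq b' b, metric_eq b' b, dualForm_modelForm]
  refine ⟨crossEnd b' X, derivation_crossEnd_modelForm b' X, fun u v w x => ?_⟩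
  rw [derivation_crossEnd_modelDual, AlternatingMap.neg_apply, alternatizeUncurryFin_four]
  simp only [LinearMap.smulRight_apply, AlternatingMap.smul_apply, smul_eq_mul,
    metric_modelForm, LinearMap.sum_apply, LinearMap.smul_apply, Basis.coord_apply,
    mul_comm (b'.repr X _)]
  ring

end Cross
-- Naturality under linear automorphisms
section Equivariance

variable {V : Type*} [AddCommGroup V] [Module ℝ V]

theorem topForm_compLinearMap (φ : V [⋀^Fin 3]→ₗ[ℝ] ℝ) (f : V →ₗ[ℝ] V) (u v : V) :
    topForm (φ.compLinearMap f) u v = (topForm φ (f u) (f v)).compLinearMap f := by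
  rw [topForm, topForm, ← wedge_compLinearMap, ← wedge_compLinearMap,
    AlternatingMap.curryLeft_compLinearMap, AlternatingMap.curryLeft_compLinearMap]

/-- Pulling the form back by `f` and moving the basis by the inverse of `f` leaves all components
unchanged. Naturality of the metric, the volume form and the raised frame rests on this. -/
theorem matrixB_compLinearMap (b : Basis (Fin 7) ℝ V) (φ : V [⋀^Fin 3]→ₗ[ℝ] ℝ) (f : V ≃ₗ[ℝ] V) :
    matrixB (b.map f.symm) (φ.compLinearMap (f : V →ₗ[ℝ] V)) = matrixB b φ := by
  ext i j
  simp only [matrixB_apply, topForm_compLinearMap, AlternatingMap.compLinearMap_apply]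
  simp

theorem metric_compLinearMap (b : Basis (Fin 7) ℝ V) (φ : V [⋀^Fin 3]→ₗ[ℝ] ℝ) (f : V ≃ₗ[ℝ] V)
    (u v : V) : metric (b.map f.symm) (φ.compLinearMap (f : V →ₗ[ℝ] V)) u v =
      metric b φ (f u) (f v) := by
  rw [metric, metric, matrixB_compLinearMap, topForm_compLinearMap,
    AlternatingMap.compLinearMap_apply]
  simp

theorem volumeForm_compLinearMap (b : Basis (Fin 7) ℝ V) (φ : V [⋀^Fin 3]→ₗ[ℝ] ℝ)
    (f : V ≃ₗ[ℝ] V) : volumeForm (b.map f.symm) (φ.compLinearMap (f : V →ₗ[ℝ] V)) =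
      (volumeForm b φ).compLinearMap (f : V →ₗ[ℝ] V) := by
  rw [volumeForm, volumeForm, matrixB_compLinearMap, Basis.det_map']
  ext v
  simp [AlternatingMap.smul_apply]

theorem gram_compLinearMap (b : Basis (Fin 7) ℝ V) (φ : V [⋀^Fin 3]→ₗ[ℝ] ℝ) (f : V ≃ₗ[ℝ] V) :
    gram (metric (b.map f.symm) (φ.compLinearMap (f : V →ₗ[ℝ] V))) (b.map f.symm) =
      gram (metric b φ) b := by
  ext i j
  simp [gram, metric_compLinearMap]

theorem map_raised_compLinearMap (b : Basis (Fin 7) ℝ V) (φ : V [⋀^Fin 3]→ₗ[ℝ] ℝ) (f : V ≃ₗ[ℝ] V)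
    (a : Fin 7) :
    f (raised (metric (b.map f.symm) (φ.compLinearMap (f : V →ₗ[ℝ] V))) (b.map f.symm) a) =
      raised (metric b φ) b a := by
  rw [raised, gram_compLinearMap]
  simp [raised]

/-- The dual form is natural under linear automorphisms. -/
theorem dualForm_compLinearMap (b : Basis (Fin 7) ℝ V) (φ : V [⋀^Fin 3]→ₗ[ℝ] ℝ) (f : V ≃ₗ[ℝ] V) :
    dualForm b (φ.compLinearMap (f : V →ₗ[ℝ] V)) =
      (dualForm b φ).compLinearMap (f : V →ₗ[ℝ] V) := by
  -- Basis independence allows the left side to be computed in the moved basis, where it agrees with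
  -- the right side term by term.
  rw [← dualForm_eq b (b.map f.symm)]
  ext v
  rw [AlternatingMap.compLinearMap_apply, dualForm, dualForm, hodgeStar_apply, hodgeStar_apply,
    volumeForm_compLinearMap]
  congr 1
  refine Finset.sum_congr rfl fun i _ => Finset.sum_congr rfl fun j _ =>
    Finset.sum_congr rfl fun k _ => ?_
  simp only [AlternatingMap.compLinearMap_apply]
  congr 1
  · congr 1
    funext m; fin_cases m <;> simp
  · congr 1
    funext m
    refine Fin.cases (map_raised_compLinearMap b φ f i) (fun m => ?_) m
    refine Fin.cases (map_raised_compLinearMap b φ f j) (fun m => ?_) m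
    exact Fin.cases (map_raised_compLinearMap b φ f k) (fun m => rfl) m

end Equivariance

/-! ### Differentiability of the dual form as a function of the three-form -/

section Differentiability

variable {V : Type*} [AddCommGroup V] [Module ℝ V]
  {E : Type*} [NormedAddCommGroup E] [NormedSpace ℝ E]

theorem differentiableAt_matrix_det {n : Type*} [Fintype n] [DecidableEq n] {A : E → Matrix n n ℝ}
    {c : E} (hA : ∀ i j, DifferentiableAt ℝ (fun x => A x i j) c) :
    DifferentiableAt ℝ (fun x => (A x).det) c := by
  simp only [Matrix.det_apply, Units.smul_def, zsmul_eq_mul]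
  fun_prop

theorem differentiableAt_matrix_inv {n : Type*} [Fintype n] [DecidableEq n] {A : E → Matrix n n ℝ}
    {c : E} (hA : ∀ i j, DifferentiableAt ℝ (fun x => A x i j) c) (h0 : (A c).det ≠ 0) (i j : n) :
    DifferentiableAt ℝ (fun x => (A x)⁻¹ i j) c := by
  simp only [Matrix.inv_def, Matrix.smul_apply, smul_eq_mul, Matrix.adjugate_apply,
    Ring.inverse_eq_inv']
  refine ((differentiableAt_matrix_det hA).inv h0).mul (differentiableAt_matrix_det fun k l => ?_)
  by_cases hk : k = j
  · subst hk
    simp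
  · simpa [Matrix.updateRow_ne hk] using hA k l

theorem differentiableAt_ninthRoot {x : ℝ} (hx : x ≠ 0) : DifferentiableAt ℝ ninthRoot x := by
  have h : DifferentiableAt ℝ (fun y : ℝ => |y| ^ (1 / 9 : ℝ)) x :=
    ((differentiableAt_abs hx).rpow_const (Or.inl (abs_ne_zero.2 hx)))
  rcases hx.lt_or_gt with hx | hx
  · refine (h.const_mul (-1)).congr_of_eventuallyEq ?_
    filter_upwards [eventually_lt_nhds hx] with y hy
    rw [ninthRoot, Real.sign_of_neg hy]
  · refine (h.const_mul 1).congr_of_eventuallyEq ?_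
    filter_upwards [eventually_gt_nhds hx] with y hy
    rw [ninthRoot, Real.sign_of_pos hy]

theorem ninthRoot_ne_zero {x : ℝ} (hx : x ≠ 0) : ninthRoot x ≠ 0 :=
  mul_ne_zero (by simpa using hx) (Real.rpow_pos_of_pos (abs_pos.2 hx) _).ne'

variable [FiniteDimensional ℝ E]

theorem LinearMap.differentiable_real (f : E →ₗ[ℝ] ℝ) : Differentiable ℝ f :=
  (LinearMap.toContinuousLinearMap f).differentiable

/-- The value is a cubic polynomial in the coordinates of `c`. Parametrizing forms linearly by a
normed space `E` avoids putting a norm on the space of alternating maps. -/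
theorem differentiable_topForm (R : E →ₗ[ℝ] V [⋀^Fin 3]→ₗ[ℝ] ℝ) (u v : V) (w : Fin 7 → V) :
    Differentiable ℝ (fun c => topForm (R c) u v w) := by
  have hx : ∀ p, Differentiable ℝ (fun c => (finBasis ℝ E).repr c p) :=
    fun p => LinearMap.differentiable_real ((finBasis ℝ E).coord p)
  have h : ∀ c, topForm (R c) u v w = ∑ p, ∑ q, ∑ r, (finBasis ℝ E).repr c p *
      ((finBasis ℝ E).repr c q * ((finBasis ℝ E).repr c r *
      evalAt w (wedgeHom V (show 4 + 3 = 7 from rfl) (wedgeHom V (show 2 + 2 = 4 from rfl)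
        ((R (finBasis ℝ E r)).curryLeft u) ((R (finBasis ℝ E q)).curryLeft v))
          (R (finBasis ℝ E p))))) := by
    intro c
    conv_lhs => rw [← (finBasis ℝ E).sum_repr c]
    simp only [topForm, ← evalAt_apply, ← wedgeHom_apply, ← AlternatingMap.curryLeftLinearMap_apply,
      map_sum, map_smul, LinearMap.sum_apply, LinearMap.smul_apply, smul_eq_mul, Finset.mul_sum]
  simp only [h]
  fun_prop

variable (b : Basis (Fin 7) ℝ V) (R : E →ₗ[ℝ] V [⋀^Fin 3]→ₗ[ℝ] ℝ) {c : E}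

theorem differentiableAt_ninthRoot_matrixB (hc : (matrixB b (R c)).det ≠ 0) :
    DifferentiableAt ℝ (fun x => ninthRoot (matrixB b (R x)).det) c :=
  DifferentiableAt.comp c (f := fun x => (matrixB b (R x)).det) (differentiableAt_ninthRoot hc)
    (differentiableAt_matrix_det fun i j =>
      (differentiable_topForm R (b i) (b j) b).differentiableAt)

theorem differentiableAt_metric (hc : (matrixB b (R c)).det ≠ 0) (u v : V) :
    DifferentiableAt ℝ (fun x => metric b (R x) u v) c := by
  have h1 := differentiableAt_ninthRoot_matrixB b R hc
  have h2 : DifferentiableAt ℝ (fun x => topForm (R x) u v b) c :=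
    (differentiable_topForm R u v b).differentiableAt
  have h3 : DifferentiableAt ℝ (fun x => (ninthRoot (matrixB b (R x)).det)⁻¹) c :=
    h1.inv (ninthRoot_ne_zero hc)
  simp only [metric, div_eq_mul_inv]
  exact (h2.mul h3).const_mul _

theorem det_gram_metric_ne_zero {φ : V [⋀^Fin 3]→ₗ[ℝ] ℝ} (hc : (matrixB b φ).det ≠ 0) :
    (gram (metric b φ) b).det ≠ 0 := by
  have h : gram (metric b φ) b =
      ((6 : ℝ) ^ (-(2 / 9) : ℝ) / ninthRoot (matrixB b φ).det) • matrixB b φ := by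
    ext i j
    rw [gram, metric, Matrix.smul_apply, matrixB_apply, smul_eq_mul]
    ring
  rw [h, Matrix.det_smul]
  exact mul_ne_zero (pow_ne_zero _ (div_ne_zero (by positivity) (ninthRoot_ne_zero hc))) hc

/-- The map `φ ↦ ψ` is differentiable at forms with nondegenerate `B`. -/
theorem differentiableAt_dualForm (hc : (matrixB b (R c)).det ≠ 0) (v : Fin 4 → V) :
    DifferentiableAt ℝ (fun x => dualForm b (R x) v) c := by
  -- Expanding the raised vectors leaves only components of `φ`, the ninth root, entries of the
  -- inverse Gram matrix and constants.
  have hv : ∀ (φ : V [⋀^Fin 3]→ₗ[ℝ] ℝ), dualForm b φ v = 1 / 6 * ∑ i, ∑ j, ∑ k,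
      φ ![b i, b j, b k] * (-((6 : ℝ) ^ (-(7 / 9) : ℝ) * ninthRoot (matrixB b φ).det) *
        ∑ p, ∑ q, ∑ r, (gram (metric b φ) b)⁻¹ k p * ((gram (metric b φ) b)⁻¹ j q *
          ((gram (metric b φ) b)⁻¹ i r * b.det (Matrix.vecCons (b r) (Matrix.vecCons (b q)
            (Matrix.vecCons (b p) v)))))) := by
    intro φ
    rw [dualForm, hodgeStar_apply, volumeForm]
    congr 1
    refine Finset.sum_congr rfl fun i _ => Finset.sum_congr rfl fun j _ =>
      Finset.sum_congr rfl fun k _ => ?_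
    rw [AlternatingMap.smul_apply, smul_eq_mul]
    congr 2
    simp only [raised, ← AlternatingMap.curryLeft_apply_apply, ← evalAt_apply v]
    simp only [← AlternatingMap.curryLeftLinearMap_apply, map_sum, map_smul, LinearMap.sum_apply,
      LinearMap.smul_apply, smul_eq_mul, Finset.mul_sum]
  have h1 := differentiableAt_ninthRoot_matrixB b R hc
  have h2 := differentiableAt_matrix_inv (A := fun x => gram (metric b (R x)) b)
    (fun i j => differentiableAt_metric b R hc (b i) (b j)) (det_gram_metric_ne_zero b hc)
  have h3 : ∀ i j k, DifferentiableAt ℝ (fun x => R x ![b i, b j, b k]) c := fun i j k =>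
    (LinearMap.differentiable_real (evalAt ![b i, b j, b k] ∘ₗ R)).differentiableAt
  simp only [hv]
  refine DifferentiableAt.const_mul (DifferentiableAt.fun_sum fun i _ => DifferentiableAt.fun_sum
    fun j _ => DifferentiableAt.fun_sum fun k _ => ?_) _
  refine (h3 i j k).fun_mul ((h1.const_mul _).fun_neg.fun_mul ?_)
  exact DifferentiableAt.fun_sum fun p _ => DifferentiableAt.fun_sum fun q _ =>
    DifferentiableAt.fun_sum fun r _ =>
      (h2 k p).fun_mul ((h2 j q).fun_mul ((h2 i r).mul_const _))

end Differentiability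

/-! ### Evolution of the dual form at a point -/

section Flow

variable {V : Type*} [AddCommGroup V] [Module ℝ V]

/-- The ninth root of the determinant scales by the nonzero factor `b'.det b` under change of basis,
and it equals `6^(7/9)` in the adapted basis. -/
theorem det_matrixB_ne_zero (b : Basis (Fin 7) ℝ V) {φ : V [⋀^Fin 3]→ₗ[ℝ] ℝ} (hφ : IsPositive φ) :
    (matrixB b φ).det ≠ 0 := by
  obtain ⟨b', rfl⟩ := hφ
  intro h
  have h1 := ninthRoot_matrixB b' b (modelForm b')
  rw [h, ninthRoot_det_modelForm] at h1
  have h2 : (6 : ℝ) ^ (7 / 9 : ℝ) ≠ 0 := by positivity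
  refine mul_ne_zero (b'.isUnit_det b).ne_zero h2 (h1.symm.trans ?_)
  simp [ninthRoot]

/-- The components of a three-form in a basis. -/
def components (b : Basis (Fin 7) ℝ V) :
    (V [⋀^Fin 3]→ₗ[ℝ] ℝ) →ₗ[ℝ] (Fin 7 → Fin 7 → Fin 7 → ℝ) :=
  LinearMap.pi fun i => LinearMap.pi fun j => LinearMap.pi fun k => evalAt ![b i, b j, b k]

theorem components_injective (b : Basis (Fin 7) ℝ V) : Function.Injective (components b) :=
  fun φ φ' h => ext_three b fun i j k _ _ => congrFun (congrFun (congrFun h i) j) k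

theorem hasDerivWithinAt_components (b : Basis (Fin 7) ℝ V) (φ : ℝ → V [⋀^Fin 3]→ₗ[ℝ] ℝ)
    (φ' : V [⋀^Fin 3]→ₗ[ℝ] ℝ) {J : Set ℝ} {t : ℝ}
    (h : ∀ i j k, HasDerivWithinAt (fun s => φ s ![b i, b j, b k]) (φ' ![b i, b j, b k]) J t) :
    HasDerivWithinAt (fun s => components b (φ s)) (components b φ') J t :=
  hasDerivWithinAt_pi.2 fun i => hasDerivWithinAt_pi.2 fun j => hasDerivWithinAt_pi.2 fun k =>
    h i j k

theorem eventually_det_ne_zero (b : Basis (Fin 7) ℝ V) (A : V →ₗ[ℝ] V) :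
    ∀ᶠ s : ℝ in nhds 0, (LinearMap.toMatrix b b (LinearMap.id + s • A)).det ≠ 0 := by
  have h : ContinuousAt (fun s : ℝ => (LinearMap.toMatrix b b (LinearMap.id + s • A)).det) 0 := by
    refine (differentiableAt_matrix_det fun i j => ?_).continuousAt
    simp only [map_add, map_smul, Matrix.add_apply, Matrix.smul_apply, smul_eq_mul]
    fun_prop
  refine h.eventually_ne ?_
  simp

theorem eventually_dualForm_compLinearMap (b : Basis (Fin 7) ℝ V) (A : V →ₗ[ℝ] V)
    (φ : V [⋀^Fin 3]→ₗ[ℝ] ℝ) : ∀ᶠ s : ℝ in nhds 0,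
      dualForm b (φ.compLinearMap (LinearMap.id + s • A)) =
        (dualForm b φ).compLinearMap (LinearMap.id + s • A) := by
  filter_upwards [eventually_det_ne_zero b A] with s hs
  exact dualForm_compLinearMap b φ (LinearEquiv.ofIsUnitDet (isUnit_iff_ne_zero.2 hs))

/-- If a family of three-forms evolves infinitesimally by an endomorphism, then the family of dual
forms evolves by the same endomorphism. -/
theorem hasDerivWithinAt_dualForm (b : Basis (Fin 7) ℝ V) {φ : ℝ → V [⋀^Fin 3]→ₗ[ℝ] ℝ}
    {J : Set ℝ} {t : ℝ} (h0 : (matrixB b (φ t)).det ≠ 0) (A : V →ₗ[ℝ] V)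
    (h : ∀ i j k, HasDerivWithinAt (fun s => φ s ![b i, b j, b k])
      (derivation A (φ t) ![b i, b j, b k]) J t) (u v w x : V) :
    HasDerivWithinAt (fun s => dualForm b (φ s) ![u, v, w, x])
      (derivation A (dualForm b (φ t)) ![u, v, w, x]) J t := by
  -- Components live in a normed space, and the left inverse `R` rebuilds the form from them, so `φ
  -- ↦ ψ` can be differentiated there.
  obtain ⟨R, hR⟩ := LinearMap.exists_leftInverse_of_injective (components b)
    (LinearMap.ker_eq_bot.2 (components_injective b))
  have hR' : ∀ α, R (components b α) = α := fun α => LinearMap.congr_fun hR α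
  have hF := (differentiableAt_dualForm b R (c := components b (φ t)) (by rwa [hR'])
    ![u, v, w, x]).hasFDerivAt
  have h1 := hF.comp_hasDerivWithinAt t (hasDerivWithinAt_components b _ _ h)
  -- The comparison curve `(id + sA)^* φ(t)` passes through `φ(t)` at `s = 0` with the same velocity
  -- as the given family.
  have h2 : HasDerivAt (fun s : ℝ => components b ((φ t).compLinearMap (LinearMap.id + s • A)))
      (components b (derivation A (φ t))) 0 := by
    rw [← hasDerivWithinAt_univ]
    refine hasDerivWithinAt_components b _ _ fun i j k => ?_
    rw [hasDerivWithinAt_univ, derivation_three, add_assoc]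
    refine (hasDerivAt_map_three (φ t) (b i) (b j) (b k) (A (b i)) (A (b j))
      (A (b k))).congr_of_eventuallyEq (Filter.Eventually.of_forall fun s => ?_)
    dsimp only
    rw [AlternatingMap.compLinearMap_apply]
    congr 1
    funext m; fin_cases m <;> rfl
  have hφ : (φ t).compLinearMap (LinearMap.id + (0 : ℝ) • A) = φ t := by
    rw [zero_smul, add_zero, AlternatingMap.compLinearMap_id]
  have h3 := HasFDerivAt.comp_hasDerivAt (0 : ℝ) (by rw [hφ]; exact hF) h2
  -- For small `s` the map `id + sA` is invertible, so by naturality the dual of the comparison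
  -- curve is the pullback of `ψ(t)`.
  have h4 : HasDerivAt (fun s : ℝ => dualForm b ((φ t).compLinearMap (LinearMap.id + s • A))
      ![u, v, w, x]) (derivation A (dualForm b (φ t)) ![u, v, w, x]) 0 := by
    rw [derivation_four, add_assoc, add_assoc]
    refine (hasDerivAt_map_four (dualForm b (φ t)) u v w x (A u) (A v) (A w)
      (A x)).congr_of_eventuallyEq ?_
    filter_upwards [eventually_dualForm_compLinearMap b A (φ t)] with s hs
    rw [hs, AlternatingMap.compLinearMap_apply]
    congr 1
    funext m; fin_cases m <;> rfl
  simp only [Function.comp_def, hR'] at h1 h3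
  -- The Fréchet derivative takes the same value on both velocities. Uniqueness is applied to the
  -- comparison curve, defined near `0` on both sides, so `J` can be arbitrary.
  rwa [h3.unique h4] at h1

/-- The evolution of the dual form under the general flow, at a point: if the forms `φ s` satisfy
`φ' = A · φ + X ⌟ ψ` at time `t`, then `ψ' = A · ψ - X^♭ ∧ φ`. -/
theorem hasDerivWithinAt_dualForm_of_flow (b : Basis (Fin 7) ℝ V) {φ : ℝ → V [⋀^Fin 3]→ₗ[ℝ] ℝ}
    {J : Set ℝ} {t : ℝ} (hφ : IsPositive (φ t)) (A : V →ₗ[ℝ] V) (X : V)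
    (h : ∀ i j k, HasDerivWithinAt (fun s => φ s ![b i, b j, b k])
      (derivation A (φ t) ![b i, b j, b k] + dualForm b (φ t) ![X, b i, b j, b k]) J t)
    (u v w x : V) :
    HasDerivWithinAt (fun s => dualForm b (φ s) ![u, v, w, x])
      (derivation A (dualForm b (φ t)) ![u, v, w, x]
        - metric b (φ t) u X * φ t ![v, w, x] + metric b (φ t) v X * φ t ![u, w, x]
        - metric b (φ t) w X * φ t ![u, v, x] + metric b (φ t) x X * φ t ![u, v, w]) J t := by
  obtain ⟨C, hC, hC'⟩ := exists_derivation_eq_contraction b hφ X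
  -- Both parts of the velocity are absorbed in the single endomorphism `A + C`.
  have h1 := hasDerivWithinAt_dualForm b (det_matrixB_ne_zero b hφ) (A + C) (J := J)
    (fun i j k => by rw [derivation_add_left, hC]; exact h i j k) u v w x
  rw [derivation_add_left, AlternatingMap.add_apply, hC'] at h1
  refine h1.congr_deriv ?_
  ring

theorem derivation_toLin_three (b : Basis (Fin 7) ℝ V) (N : Matrix (Fin 7) (Fin 7) ℝ)
    (f : V [⋀^Fin 3]→ₗ[ℝ] ℝ) (i j k : Fin 7) :
    derivation (Matrix.toLin b b N) f ![b i, b j, b k] =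
      ∑ m, (N m i * f ![b m, b j, b k] + N m j * f ![b i, b m, b k]
        + N m k * f ![b i, b j, b m]) := by
  rw [derivation_three]
  simp only [Matrix.toLin_self]
  simp only [map_three_eq, ← AlternatingMap.curryLeftLinearMap_apply, map_sum, map_smul,
    LinearMap.sum_apply, LinearMap.smul_apply, smul_eq_mul, Finset.sum_add_distrib]

theorem derivation_toLin_four (b : Basis (Fin 7) ℝ V) (N : Matrix (Fin 7) (Fin 7) ℝ)
    (f : V [⋀^Fin 4]→ₗ[ℝ] ℝ) (i j k l : Fin 7) :
    derivation (Matrix.toLin b b N) f ![b i, b j, b k, b l] =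
      ∑ m, (N m i * f ![b m, b j, b k, b l] + N m j * f ![b i, b m, b k, b l]
        + N m k * f ![b i, b j, b m, b l] + N m l * f ![b i, b j, b k, b m]) := by
  rw [derivation_four]
  simp only [Matrix.toLin_self]
  simp only [map_four_eq, ← AlternatingMap.curryLeftLinearMap_apply, map_sum, map_smul,
    LinearMap.sum_apply, LinearMap.smul_apply, smul_eq_mul, Finset.sum_add_distrib]

theorem metric_eq_sum (b : Basis (Fin 7) ℝ V) (φ : V [⋀^Fin 3]→ₗ[ℝ] ℝ) (u X : V) :
    metric b φ u X = ∑ l, metric b φ u (b l) * b.repr X l := by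
  conv_lhs => rw [← b.sum_repr X]
  simp only [metric, topForm, ← wedgeHom_apply, ← evalAt_apply, map_sum, map_smul,
    LinearMap.sum_apply, LinearMap.smul_apply, smul_eq_mul, Finset.sum_div, Finset.mul_sum]
  refine Finset.sum_congr rfl fun _ _ => by ring

end Flow

/-! ### Coordinate frames of charts -/

section Manifold

variable {M : Type*} [TopologicalSpace M] [ChartedSpace (EuclideanSpace ℝ (Fin 7)) M]

theorem mdifferentiable_of_mem_maximalAtlas
    {e : OpenPartialHomeomorph M (EuclideanSpace ℝ (Fin 7))}
    (he : e ∈ IsManifold.maximalAtlas (𝓡 7) ∞ M) : e.MDifferentiable (𝓡 7) (𝓡 7) :=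
  ⟨(contMDiffOn_of_mem_maximalAtlas he).mdifferentiableOn (by simp),
    (contMDiffOn_symm_of_mem_maximalAtlas he).mdifferentiableOn (by simp)⟩

/-- The coordinate vector fields of a chart form a basis at each point, whose coordinate functions
are the components of tangent vectors. -/
theorem exists_coordFrame_basis {e : OpenPartialHomeomorph M (EuclideanSpace ℝ (Fin 7))}
    (he : e ∈ IsManifold.maximalAtlas (𝓡 7) ∞ M) {y : EuclideanSpace ℝ (Fin 7)}
    (hy : y ∈ e.target) : ∃ b : Basis (Fin 7) ℝ (TangentSpace (𝓡 7) (e.symm y)),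
      ⇑b = coordFrame e y ∧ ∀ v l, b.repr v l = coordComponent e y v l := by
  have hm := mdifferentiable_of_mem_maximalAtlas he
  have h1 := hm.comp_symm_deriv hy
  have h2 := hm.symm_comp_deriv (e.map_target hy)
  rw [e.right_inv hy] at h2
  let L : EuclideanSpace ℝ (Fin 7) ≃ₗ[ℝ] TangentSpace (𝓡 7) (e.symm y) :=
    LinearEquiv.ofLinearMap (mfderiv (𝓡 7) (𝓡 7) e.symm y).toLinearMap
      (mfderiv (𝓡 7) (𝓡 7) e (e.symm y)).toLinearMap
      (LinearMap.ext fun v => DFunLike.congr_fun h2 v)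
      (LinearMap.ext fun v => DFunLike.congr_fun h1 v)
  refine ⟨(EuclideanSpace.basisFun (Fin 7) ℝ).toBasis.map L, ?_, fun v l => ?_⟩
  · funext i
    rw [Basis.map_apply, OrthonormalBasis.coe_toBasis, EuclideanSpace.basisFun_apply]
    rfl
  · rw [Basis.map_repr]
    rfl

end Manifold

end G2Flow

end

theorem mainTheorem4 {M : Type*} [TopologicalSpace M]
    [ChartedSpace (EuclideanSpace ℝ (Fin 7)) M] [IsManifold (𝓡 7) ∞ M]
    (J : Set ℝ) (φ : ℝ → G2Flow.G2Structure M)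
    (h : ℝ → ∀ x : M, LinearMap.BilinForm ℝ (TangentSpace (𝓡 7) x))
    (X : ℝ → ∀ x : M, TangentSpace (𝓡 7) x)
    (hsymm : ∀ t ∈ J, ∀ x, (h t x).IsSymm)
    (hflow : G2Flow.IsGeneralFlow J φ h X) :
    ∀ t ∈ J, ∀ e ∈ IsManifold.maximalAtlas (𝓡 7) ∞ M, ∀ y ∈ e.target, ∀ i j k l : Fin 7,
      HasDerivWithinAt (fun s => (φ s).psiComp e y i j k l)
        ((∑ m, ((φ t).mixedComp e y (h t (e.symm y)) m i * (φ t).psiComp e y m j k l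
            + (φ t).mixedComp e y (h t (e.symm y)) m j * (φ t).psiComp e y i m k l
            + (φ t).mixedComp e y (h t (e.symm y)) m k * (φ t).psiComp e y i j m l
            + (φ t).mixedComp e y (h t (e.symm y)) m l * (φ t).psiComp e y i j k m))
          - (φ t).lowerComp e y (X t (e.symm y)) i * (φ t).phiComp e y j k l
          + (φ t).lowerComp e y (X t (e.symm y)) j * (φ t).phiComp e y i k l
          - (φ t).lowerComp e y (X t (e.symm y)) k * (φ t).phiComp e y i j l
          + (φ t).lowerComp e y (X t (e.symm y)) l * (φ t).phiComp e y i j k) J t := by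
  intro t ht e he y hy i j k l
  obtain ⟨b, hb, hrepr⟩ := G2Flow.exists_coordFrame_basis he hy
  -- `psi` and `metric` are defined with the preferred chart at the point; basis independence moves
  -- them to the frame of `e`.
  have hψ : ∀ s, (φ s).psi (e.symm y) = G2Flow.dualForm b ((φ s).form (e.symm y)) := fun s =>
    G2Flow.dualForm_eq b (G2Flow.tangentBasis (e.symm y)) _
  have hg : (φ t).metric (e.symm y) = G2Flow.metric b ((φ t).form (e.symm y)) :=
    G2Flow.metric_eq b (G2Flow.tangentBasis (e.symm y)) _
  have hX : ∀ k, (φ t).lowerComp e y (X t (e.symm y)) k =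
      G2Flow.metric b ((φ t).form (e.symm y)) (b k) (X t (e.symm y)) := fun k => by
    rw [G2Flow.metric_eq_sum]
    simp only [G2Flow.G2Structure.lowerComp, G2Flow.G2Structure.metricComp, G2Flow.gram, hg, hb,
      hrepr]
  -- The endomorphism with matrix `h^m_i` in the coordinate frame turns the `h`-terms of the flow
  -- into a derivation.
  have h1 := G2Flow.hasDerivWithinAt_dualForm_of_flow b (φ := fun s => (φ s).form (e.symm y))
    (J := J) ((φ t).positive (e.symm y))
    (Matrix.toLin b b (Matrix.of ((φ t).mixedComp e y (h t (e.symm y))))) (X t (e.symm y))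
    (fun i j k => by
      refine (hflow t ht e he y hy i j k).congr_deriv ?_ |>.congr_of_eventuallyEq ?_ ?_
      · rw [G2Flow.derivation_toLin_three, G2Flow.map_vecCons_eq_sum b (X t (e.symm y)),
          ← Finset.sum_add_distrib]
        simp only [G2Flow.G2Structure.phiComp, G2Flow.G2Structure.psiComp, hψ, hb, hrepr,
          Matrix.of_apply]
      · simp only [G2Flow.G2Structure.phiComp, hb]
        rfl
      · simp only [G2Flow.G2Structure.phiComp, hb])
    (b i) (b j) (b k) (b l)
  rw [G2Flow.derivation_toLin_four] at h1
  simp only [hX, G2Flow.G2Structure.phiComp, G2Flow.G2Structure.psiComp, hψ, ← hb]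
  exact h1
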